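/- Let $N\ge 1$ and $\alpha\in[0,1]$. For $\mathbf x=(x,y)\in\mathbb R^2\setminus\{0\}$ put $\mathbf x^{-\perp}=(-y,x)/(x^2+y^2)$, and on $\mathbb R^{2N}=(\mathbb R^2)^N$ let $$D_j=-i\nabla_{\mathbf x_j}+\alpha\sum_{k\ne j}(\mathbf x_j-\mathbf x_k)^{-\perp},\qquad j=1,\dots,N .$$ Let $\mathscr D^N_\alpha$ be the set of all permutation-symmetric $\Psi\in L^2(\mathbb R^{2N};\mathbb C)$ such that, for every $j$, $D_j\Psi$, taken in the sense of distributions on $\{(\mathbf x_1,\dots,\mathbf x_N):\mathbf x_k\neq\mathbf x_l \text{ for } k\neq l\}$, belongs to $L^2$. Let $Q_0=[0,1]^2$, and define the Dirichlet ground-state energy of $N$ ideal anyons with statistics parameter $\alpha$ on the unit square by $$E^D_N(\alpha)=\inf\Big\{\sum_{j=1}^N\int_{Q_0^N}|D_j\Psi|^2\ :\ \Psi\in\mathscr D^N_\alpha,\ \Psi \text{ has compact support in } \big((0,1)^2\big)^N,\ \int_{Q_0^N}|\Psi|^2=1\Big\}.$$ **Proposition (Global upper bound).** There exists a constant $C>0$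 such that for all $0\le\alpha\le1$ and all integers $N\ge1$, $$E^D_N(\alpha)\le C\,(N+\alpha N^2).$$ -/

import Mathlib

open MeasureTheory
open scoped ENNReal ContDiff

namespace Anyon

/-- The one-particle configuration space `ℝ²`. -/
abbrev Plane : Type := EuclideanSpace ℝ (Fin 2)

/-- The `N`-particle configuration space `(ℝ²)^N = ℝ^{2N}`, with Lebesgue measure. -/
abbrev Config (N : ℕ) : Type := Fin N → Plane

/-- `x^{-⊥} = (-y, x) / (x² + y²)`, the potential of an Aharonov-Bohm flux at the origin. -/
noncomputable def invPerp (x : Plane) : Plane :=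
  (‖x‖ ^ 2)⁻¹ • !₂[-(x 1), x 0]

/-- The vector potential `A_j(x) = ∑_{k ≠ j} (x_j - x_k)^{-⊥}` felt by particle `j`. -/
noncomputable def vecPot {N : ℕ} (j : Fin N) (x : Config N) : Plane :=
  ∑ k ∈ Finset.univ.erase j, invPerp (x j - x k)

/-- The set of configurations of pairwise distinct points, i.e. `ℝ^{2N}` without the diagonals. -/
def offDiagonal (N : ℕ) : Set (Config N) :=
  {x | Function.Injective x}

/-- The coordinate direction in `ℝ^{2N}` along the `i`-th coordinate of particle `j`. -/
noncomputable def direction {N : ℕ} (j : Fin N) (i : Fin 2) : Config N :=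
  Pi.single j (EuclideanSpace.single i 1)

/-- Test functions: smooth, with compact support away from the diagonals. -/
structure IsTestFunction {N : ℕ} (φ : Config N → ℂ) : Prop where
  smooth : ContDiff ℝ ∞ φ
  compact_support : HasCompactSupport φ
  support_subset : tsupport φ ⊆ offDiagonal N

/-- `G j i` is the `i`-th component of `D_j Ψ = (-i ∇_j + α A_j) Ψ` in the sense of distributions
on `ℝ^{2N}` without the diagonals (where `A_j` is smooth). -/
def IsMagneticGradient {N : ℕ} (α : ℝ) (Ψ : Config N → ℂ)
    (G : Fin N → Fin 2 → Config N → ℂ) : Prop :=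
  ∀ (j : Fin N) (i : Fin 2) (φ : Config N → ℂ), IsTestFunction φ →
    ∫ x, G j i x * φ x =
      ∫ x, Ψ x * (Complex.I * fderiv ℝ φ x (direction j i)
        + (α : ℂ) * ((vecPot j x i : ℝ) : ℂ) * φ x)

/-- Permutation symmetry (up to null sets) of an `N`-particle wave function. -/
def IsBosonic {N : ℕ} (Ψ : Config N → ℂ) : Prop :=
  ∀ σ : Equiv.Perm (Fin N), (fun x : Config N => Ψ (x ∘ σ)) =ᵐ[volume] Ψ

/-- `Ψ` belongs to the (maximal) domain of `D_α = (D_j)_j` in `L²_sym(ℝ^{2N})`, with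
`D_α Ψ = G`. The family `G` is determined by `Ψ` up to null sets. -/
structure HasMagneticGradient {N : ℕ} (α : ℝ) (Ψ : Config N → ℂ)
    (G : Fin N → Fin 2 → Config N → ℂ) : Prop where
  memLp : MemLp Ψ 2 volume
  bosonic : IsBosonic Ψ
  memLp_gradient : ∀ j i, MemLp (G j i) 2 volume
  isMagneticGradient : IsMagneticGradient α Ψ G

/-- `Ω^N ⊆ ℝ^{2N}`. -/
def power (N : ℕ) (Ω : Set Plane) : Set (Config N) :=
  Set.univ.pi fun _ => Ω

/-- `Ψ` has compact (essential) support inside the `N`-fold product of the interior of `Ω`. -/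
def HasCompactSupportIn {N : ℕ} (Ω : Set Plane) (Ψ : Config N → ℂ) : Prop :=
  ∃ K : Set Plane, IsCompact K ∧ K ⊆ interior Ω ∧ ∀ᵐ x : Config N, x ∉ power N K → Ψ x = 0

/-- The kinetic energy `∑_j ∫_{Ω^N} |D_j Ψ|²`, where `G = D_α Ψ`. -/
noncomputable def kineticEnergy {N : ℕ} (Ω : Set Plane)
    (G : Fin N → Fin 2 → Config N → ℂ) : ℝ≥0∞ :=
  ∑ j, ∫⁻ x in power N Ω, ∑ i, ‖G j i x‖ₑ ^ 2

/-- The Dirichlet ground-state energy `E_N^D(α; Ω)`: the infimum of the kinetic energy over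
normalized `Ψ` in the domain of `D_α` that have compact support in `Ω`. It is `∞` if there is no
such `Ψ`. -/
noncomputable def dirichletEnergy (N : ℕ) (α : ℝ) (Ω : Set Plane) : ℝ≥0∞ :=
  sInf {e | ∃ (Ψ : Config N → ℂ) (G : Fin N → Fin 2 → Config N → ℂ),
    HasMagneticGradient α Ψ G ∧ HasCompactSupportIn Ω Ψ ∧
    ∫⁻ x in power N Ω, ‖Ψ x‖ₑ ^ 2 = 1 ∧ e = kineticEnergy Ω G}

/-- The unit square `Q₀ = [0,1]²`. -/
def unitSquare : Set Plane :=
  {x | ∀ i, x i ∈ Set.Icc (0 : ℝ) 1}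

end Anyon

namespace Anyon

open Filter Topology

/-! Divide the square into cells of side `1/m` and build a trial state from three kinds of factors.
A one-particle amplitude with one bump per cell vanishes near the grid lines and costs an energy of
order `m²` per particle. On its support the cell indices are locally constant, so for two particles
in different cells the potential is locally the gradient of a branch of the argument, and a phase
removes it completely. Two particles at distance `r` in a common cell get the Jastrow factor `(m r /
2)^α ≤ 1`; what remains of their interaction is at most `2α/r` in each component of `D_j`
(`norm_trialGrad_le`).

Squaring this remainder produces two-body terms `α²/r²` and three-body terms `α²/(r r')`. The
Jastrow weight makes the first integrable: the integral of `α² r^(2α-2)` over a disk is of order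
`α`, and the scale `m` drops out (`lintegral_pairRepulsion_sq_le`). In the second, `1/r` is
integrable as it stands and each factor contributes order `α/m` (`lintegral_pairRepulsion_le`).

These integrals are compared with the norm of the state by integrating out one particle at a time
(`lintegral_le_of_slice`). This works because, whatever the positions of the others, the conditional
mass of one particle stays above a fixed constant (`lintegral_bump_mul_corr_ge`): the Jastrow
factors remove a mass of order at most `αN/m²`, which is harmless once `m²` exceeds a multiple of
`αN`.

The energy per particle is thus of order `m² + αN + α²N²/m²`. Choosing `m²` of order `1 + αN` makes
every term of order at most `1 + αN`, and summing over the particles gives the bound. -/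

/-! ### One-particle amplitude: a grid of bumps. -/

/-- A smooth `1/m`-periodic array of bumps on the line, vanishing near `m⁻¹ℤ`. -/
noncomputable def bumpWave (m : ℕ) (t : ℝ) : ℝ :=
  Real.smoothTransition (-Real.cos (2 * Real.pi * (m * t)))

/-- The bumps of `bumpWave m` that lie in the unit interval. -/
noncomputable def bumpLine (m : ℕ) : ℝ → ℝ :=
  (Set.Icc (0 : ℝ) 1).indicator (bumpWave m)

lemma contDiff_bumpWave (m : ℕ) : ContDiff ℝ 1 (bumpWave m) := by
  unfold bumpWave
  exact (Real.smoothTransition.contDiff (n := 1)).comp (by fun_prop)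

lemma bumpWave_eventually_zero (m : ℕ) {t : ℝ} (n : ℤ) (h : m * t = n) :
    bumpWave m =ᶠ[𝓝 t] 0 := by
  have hc : Continuous fun s : ℝ => Real.cos (2 * Real.pi * (m * s)) := by fun_prop
  have h1 : (0 : ℝ) < Real.cos (2 * Real.pi * (m * t)) := by
    rw [h, mul_comm, Real.cos_int_mul_two_pi]; norm_num
  filter_upwards [hc.continuousAt.eventually (lt_mem_nhds h1)] with s hs
  exact Real.smoothTransition.zero_of_nonpos (by linarith)

lemma bumpLine_nonneg (m : ℕ) (t : ℝ) : 0 ≤ bumpLine m t :=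
  Set.indicator_nonneg (fun _ _ => Real.smoothTransition.nonneg _) t

lemma bumpLine_le_one (m : ℕ) (t : ℝ) : bumpLine m t ≤ 1 :=
  Set.indicator_le' (fun _ _ => Real.smoothTransition.le_one _) (fun _ _ => zero_le_one) t

lemma bumpLine_eventuallyEq (m : ℕ) {t : ℝ} (ht : t ∈ Set.Ioo (0 : ℝ) 1) :
    bumpLine m =ᶠ[𝓝 t] bumpWave m := by
  filter_upwards [Ioo_mem_nhds ht.1 ht.2] with s hs
  exact Set.indicator_of_mem (Set.Ioo_subset_Icc_self hs) _

/-- The ends 0 and 1 are themselves grid points because `m` is an integer, so the indicator cuts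
where the wave already vanishes and no smoothness is lost. -/
lemma bumpLine_eventually_zero (m : ℕ) {t : ℝ}
    (ht : t ∉ Set.Ioo (0 : ℝ) 1 ∨ ∃ n : ℤ, m * t = n) : bumpLine m =ᶠ[𝓝 t] 0 := by
  by_cases hn : ∃ n : ℤ, m * t = n
  · obtain ⟨n, hn⟩ := hn
    filter_upwards [bumpWave_eventually_zero m n hn] with s hs
    by_cases h : s ∈ Set.Icc (0 : ℝ) 1 <;> simp [bumpLine, h]
    simpa using hs
  · have ht' := ht.resolve_right hn
    have : t ∉ Set.Icc (0 : ℝ) 1 := by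
      intro h
      rcases h.1.eq_or_lt with h0 | h0
      · exact hn ⟨0, by simp [← h0]⟩
      rcases h.2.eq_or_lt with h1 | h1
      · exact hn ⟨m, by simp [h1]⟩
      exact ht' ⟨h0, h1⟩
    filter_upwards [isClosed_Icc.isOpen_compl.mem_nhds this] with s hs
    exact Set.indicator_of_notMem hs _

lemma contDiff_bumpLine (m : ℕ) : ContDiff ℝ 1 (bumpLine m) := by
  rw [contDiff_iff_contDiffAt]
  intro t
  by_cases ht : t ∈ Set.Ioo (0 : ℝ) 1
  · exact (contDiff_bumpWave m).contDiffAt.congr_of_eventuallyEq (bumpLine_eventuallyEq m ht)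
  · exact contDiffAt_const.congr_of_eventuallyEq (bumpLine_eventually_zero m (Or.inl ht))

lemma exists_deriv_bumpLine_bound :
    ∃ K : ℝ, 0 < K ∧ ∀ (m : ℕ) (t : ℝ), |deriv (bumpLine m) t| ≤ K * m := by
  have hsm : ContDiff ℝ 1 Real.smoothTransition := Real.smoothTransition.contDiff (n := 1)
  obtain ⟨K, hK⟩ := (isCompact_Icc (a := (-1 : ℝ)) (b := 1)).exists_bound_of_continuousOn
    (hsm.continuous_deriv le_rfl).continuousOn
  have hK0 : 0 ≤ K := (norm_nonneg _).trans (hK 0 (by norm_num))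
  refine ⟨(K + 1) * (2 * Real.pi), by positivity, fun m t => ?_⟩
  by_cases ht : t ∈ Set.Ioo (0 : ℝ) 1
  · rw [(bumpLine_eventuallyEq m ht).deriv_eq]
    have h1 : HasDerivAt (fun s : ℝ => -Real.cos (2 * Real.pi * (m * s)))
        (Real.sin (2 * Real.pi * (m * t)) * (2 * Real.pi * m)) t := by
      have h2 : HasDerivAt (fun s : ℝ => 2 * Real.pi * (m * s)) (2 * Real.pi * m) t := by
        simpa using ((hasDerivAt_id t).const_mul (m : ℝ)).const_mul (2 * Real.pi)
      exact h2.cos.neg.congr_deriv (by ring)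
    have h3 := ((hsm.differentiable one_ne_zero).differentiableAt
      (x := -Real.cos (2 * Real.pi * (m * t)))).hasDerivAt.comp t h1
    have h4 : deriv (bumpWave m) t = _ := h3.deriv
    rw [h4, abs_mul, abs_mul]
    have h5 : |deriv Real.smoothTransition (-Real.cos (2 * Real.pi * (m * t)))| ≤ K :=
      hK _ ⟨by linarith [Real.cos_le_one (2 * Real.pi * (m * t))],
        by linarith [Real.neg_one_le_cos (2 * Real.pi * (m * t))]⟩
    have h6 := Real.abs_sin_le_one (2 * Real.pi * (m * t))
    have h7 : |2 * Real.pi * (m : ℝ)| = 2 * Real.pi * m := abs_of_nonneg (by positivity)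
    rw [h7]
    calc _ ≤ K * (1 * (2 * Real.pi * m)) := by gcongr
      _ ≤ (K + 1) * (1 * (2 * Real.pi * m)) := by gcongr; linarith
      _ = _ := by ring
  · rw [(bumpLine_eventually_zero m (Or.inl ht)).deriv_eq]
    simp; positivity

/-- Substituting `m t` and using periodicity removes `m`. Refining the grid therefore costs no mass,
which is what makes the constant `c` below uniform in `m`. -/
lemma integral_bumpLine_sq {m : ℕ} (hm : 1 ≤ m) :
    ∫ t, bumpLine m t ^ 2 = ∫ t in (0 : ℝ)..1, bumpWave 1 t ^ 2 := by
  have hm' : (m : ℝ) ≠ 0 := by positivity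
  have h1 : (fun t => bumpLine m t ^ 2) =
      (Set.Icc (0 : ℝ) 1).indicator (fun t => bumpWave m t ^ 2) := by
    ext t
    by_cases h : t ∈ Set.Icc (0 : ℝ) 1 <;> simp [bumpLine, h]
  rw [h1, integral_indicator measurableSet_Icc, integral_Icc_eq_integral_Ioc,
    ← intervalIntegral.integral_of_le zero_le_one]
  have h2 : ∀ t, bumpWave m t ^ 2 = (fun s => bumpWave 1 s ^ 2) (m * t) := by
    intro t; simp [bumpWave]
  simp_rw [h2]
  rw [intervalIntegral.integral_comp_mul_left (fun s => bumpWave 1 s ^ 2) hm']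
  have hp : Function.Periodic (fun s => bumpWave 1 s ^ 2) (1 : ℝ) := by
    intro s
    simp only [bumpWave, Nat.cast_one, one_mul]
    rw [mul_add, mul_one, Real.cos_add_two_pi]
  have h3 := hp.intervalIntegral_add_zsmul_eq m 0
    (fun _ _ => ((contDiff_bumpWave 1).continuous.pow 2).intervalIntegrable _ _)
  simp only [zero_add, natCast_zsmul, nsmul_eq_mul, mul_one] at h3
  rw [mul_zero, mul_one, h3, smul_eq_mul, inv_mul_cancel_left₀ hm']

lemma integral_bumpWave_sq_pos : 0 < ∫ t in (0 : ℝ)..1, bumpWave 1 t ^ 2 := by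
  refine intervalIntegral.integral_pos zero_lt_one
    ((contDiff_bumpWave 1).continuous.pow 2).continuousOn (fun _ _ => sq_nonneg _)
    ⟨1 / 2, by norm_num, ?_⟩
  have : bumpWave 1 (1 / 2) = 1 := by
    have : 2 * Real.pi * (((1 : ℕ) : ℝ) * (1 / 2)) = Real.pi := by push_cast; ring
    rw [bumpWave, this, Real.cos_pi]; simp
  rw [this]; norm_num

/-- The open cells of the grid of mesh `1/m` in the unit square. -/
def gridInterior (m : ℕ) : Set Plane :=
  {x | ∀ i, x i ∈ Set.Ioo (0 : ℝ) 1 ∧ ∀ n : ℤ, m * x i ≠ n}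

/-- The one-particle amplitude: one bump in each cell of the grid of mesh `1/m`. -/
noncomputable def bump (m : ℕ) (x : Plane) : ℝ := bumpLine m (x 0) * bumpLine m (x 1)

lemma bump_nonneg (m : ℕ) (x : Plane) : 0 ≤ bump m x :=
  mul_nonneg (bumpLine_nonneg _ _) (bumpLine_nonneg _ _)

lemma bump_le_one (m : ℕ) (x : Plane) : bump m x ≤ 1 :=
  mul_le_one₀ (bumpLine_le_one _ _) (bumpLine_nonneg _ _) (bumpLine_le_one _ _)

lemma contDiff_bump (m : ℕ) : ContDiff ℝ 1 (bump m) := by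
  unfold bump
  have := contDiff_bumpLine m
  exact (this.comp (by fun_prop)).mul (this.comp (by fun_prop))

lemma bump_eventually_zero {m : ℕ} {x : Plane} (hx : x ∉ gridInterior m) :
    bump m =ᶠ[𝓝 x] 0 := by
  have key : ∃ i, bumpLine m =ᶠ[𝓝 (x i)] 0 := by
    by_contra! h
    refine hx fun i => ?_
    have h1 : ¬ (x i ∉ Set.Ioo (0 : ℝ) 1 ∨ ∃ n : ℤ, m * x i = n) :=
      fun h2 => h i (bumpLine_eventually_zero m h2)
    simp only [not_or, not_not, not_exists] at h1
    exact h1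
  obtain ⟨i, hi⟩ := key
  have hc : Continuous fun y : Plane => y i := by fun_prop
  filter_upwards [hc.continuousAt.eventually hi] with y hy
  fin_cases i
  · simp only [Fin.zero_eta, Pi.zero_apply] at hy; simp [bump, hy]
  · simp only [Fin.mk_one, Pi.zero_apply] at hy; simp [bump, hy]

lemma tsupport_bump_subset (m : ℕ) : tsupport (bump m) ⊆ gridInterior m := by
  intro x hx
  by_contra h
  exact (notMem_tsupport_iff_eventuallyEq.mpr (bump_eventually_zero h)) hx

lemma abs_fderiv_bump_le {m : ℕ} {K : ℝ} (hK : ∀ t : ℝ, |deriv (bumpLine m) t| ≤ K)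
    (x : Plane) (i : Fin 2) :
    |fderiv ℝ (bump m) x (EuclideanSpace.single i 1)| ≤ K := by
  have hd : ∀ t, HasDerivAt (bumpLine m) (deriv (bumpLine m) t) t := fun t =>
    ((contDiff_bumpLine m).differentiable one_ne_zero).differentiableAt.hasDerivAt
  have hp : ∀ j : Fin 2, HasFDerivAt (fun y : Plane => y j)
      (EuclideanSpace.proj j : Plane →L[ℝ] ℝ) x :=
    fun j => (EuclideanSpace.proj j : Plane →L[ℝ] ℝ).hasFDerivAt
  have h := ((hd (x 0)).comp_hasFDerivAt x (hp 0)).mul ((hd (x 1)).comp_hasFDerivAt x (hp 1))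
  have h' : HasFDerivAt (bump m) _ x := h
  have hK0 : 0 ≤ K := (abs_nonneg _).trans (hK 0)
  have hb : ∀ a b : ℝ, |bumpLine m a * deriv (bumpLine m) b| ≤ K := fun a b => by
    rw [abs_mul, abs_of_nonneg (bumpLine_nonneg _ _)]
    calc _ ≤ 1 * K := mul_le_mul (bumpLine_le_one _ _) (hK _) (abs_nonneg _) zero_le_one
      _ = K := one_mul K
  rw [h'.fderiv]
  fin_cases i
  · simpa using hb (x 1) (x 0)
  · simpa using hb (x 0) (x 1)

lemma integral_bump_sq (m : ℕ) : ∫ x, bump m x ^ 2 = (∫ t, bumpLine m t ^ 2) ^ 2 := by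
  rw [← (PiLp.volume_preserving_toLp (Fin 2)).integral_comp
    (MeasurableEquiv.toLp 2 (Fin 2 → ℝ)).measurableEmbedding]
  have h : ∀ y : Fin 2 → ℝ, bump m (WithLp.toLp 2 y) ^ 2 = ∏ i, bumpLine m (y i) ^ 2 := by
    intro y; simp [bump, mul_pow]
  simp_rw [h]
  rw [integral_fintype_prod_volume_eq_prod (fun _ t => bumpLine m t ^ 2)]
  simp [sq]

lemma gridInterior_subset (m : ℕ) : gridInterior m ⊆ interior unitSquare := by
  have ho : IsOpen {x : Plane | ∀ i, x i ∈ Set.Ioo (0 : ℝ) 1} := by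
    rw [Set.ofPred_forall]
    exact isOpen_iInter_of_finite fun i => isOpen_Ioo.preimage (by fun_prop)
  refine fun x hx => interior_maximal ?_ ho (fun i => (hx i).1)
  exact fun y hy i => Set.Ioo_subset_Icc_self (hy i)

lemma isCompact_unitSquare : IsCompact unitSquare := by
  have : unitSquare = (EuclideanSpace.equiv (Fin 2) ℝ).toHomeomorph ⁻¹'
      (Set.univ.pi fun _ => Set.Icc (0 : ℝ) 1) := by
    ext x
    simp only [unitSquare, Set.mem_preimage, Set.mem_pi, Set.mem_univ, forall_true_left]
    rfl
  rw [this, Homeomorph.isCompact_preimage]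
  exact isCompact_univ_pi fun _ => isCompact_Icc

lemma isCompact_tsupport_bump (m : ℕ) : IsCompact (tsupport (bump m)) :=
  isCompact_unitSquare.of_isClosed_subset (isClosed_tsupport _)
    ((tsupport_bump_subset m).trans ((gridInterior_subset m).trans interior_subset))

lemma exists_lintegral_bump_sq_eq :
    ∃ c : ℝ, 0 < c ∧ ∀ m : ℕ, 1 ≤ m → ∫⁻ x, ENNReal.ofReal (bump m x ^ 2) = ENNReal.ofReal c := by
  refine ⟨_, pow_pos integral_bumpWave_sq_pos 2, fun m hm => ?_⟩
  rw [← integral_bumpLine_sq hm, ← integral_bump_sq, ofReal_integral_eq_lintegral_ofReal]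
  · refine Continuous.integrable_of_hasCompactSupport ((contDiff_bump m).continuous.pow 2) ?_
    exact HasCompactSupport.comp_left (g := fun t : ℝ => t ^ 2) (isCompact_tsupport_bump m)
      (by norm_num)
  · exact Filter.Eventually.of_forall fun _ => sq_nonneg _

/-! ### Radial integrals in the plane. -/

/-- Integrals over a disk of a power of the distance to its centre. -/
lemma lintegral_ball_rpow {s L : ℝ} (hs : -2 < s) (hL : 0 < L) (y : Plane) :
    ∫⁻ x in Metric.ball y L, ENNReal.ofReal (‖x - y‖ ^ s) =
      ENNReal.ofReal (2 * (volume : Measure Plane).real (Metric.ball 0 1) *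
        (L ^ (s + 2) / (s + 2))) := by
  set f : ℝ → ℝ := (Set.Iio L).indicator fun r => r ^ s with hf
  have hdim : Module.finrank ℝ Plane = 2 := by simp
  have h1 : ∫⁻ x in Metric.ball y L, ENNReal.ofReal (‖x - y‖ ^ s) =
      ∫⁻ x : Plane, ENNReal.ofReal (f ‖x‖) := by
    rw [← lintegral_indicator Metric.isOpen_ball.measurableSet,
      ← lintegral_sub_right_eq_self (fun x : Plane => ENNReal.ofReal (f ‖x‖)) y]
    refine lintegral_congr fun x => ?_
    by_cases hx : ‖x - y‖ < L <;> simp [hf, Set.indicator, dist_eq_norm, hx]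
  have hpow : Set.EqOn (fun r : ℝ => r ^ (Module.finrank ℝ Plane - 1) • f r)
      ((Set.Iio L).indicator fun r => r ^ (s + 1)) (Set.Ioi 0) := by
    intro r hr
    have hr' : (0 : ℝ) < r := hr
    by_cases h : r < L
    · simp [hf, h, hdim, Real.rpow_add_one hr'.ne', mul_comm]
    · simp [hf, h]
  have hint : IntervalIntegrable (fun r : ℝ => r ^ (s + 1)) volume 0 L :=
    intervalIntegral.intervalIntegrable_rpow' (by linarith)
  have hset : Set.Iio L ∩ Set.Ioi 0 = Set.Ioo 0 L := by
    ext r; simp [and_comm]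
  have h2 : IntegrableOn (fun r : ℝ => r ^ (Module.finrank ℝ Plane - 1) • f r) (Set.Ioi 0) := by
    rw [integrableOn_congr_fun hpow measurableSet_Ioi, IntegrableOn,
      integrable_indicator_iff measurableSet_Iio, IntegrableOn, Measure.restrict_restrict
      measurableSet_Iio, hset]
    exact ((intervalIntegrable_iff_integrableOn_Ioc_of_le hL.le).mp hint).mono_set
      Set.Ioo_subset_Ioc_self
  have h3 : Integrable (fun x : Plane => f ‖x‖) :=
    (integrable_fun_norm_addHaar volume).mpr h2
  have h0 : 0 ≤ᵐ[volume] fun x : Plane => f ‖x‖ :=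
    Eventually.of_forall fun x => Set.indicator_apply_nonneg fun _ => by positivity
  rw [h1, ← ofReal_integral_eq_lintegral_ofReal h3 h0, integral_fun_norm_addHaar,
    setIntegral_congr_fun measurableSet_Ioi hpow, integral_indicator measurableSet_Iio,
    Measure.restrict_restrict measurableSet_Iio, hset, ← integral_Ioc_eq_integral_Ioo,
    ← intervalIntegral.integral_of_le hL.le, integral_rpow (Or.inl (by linarith)), hdim,
    Real.zero_rpow (by linarith)]
  congr 1
  simp only [smul_eq_mul, nsmul_eq_mul]
  rw [show s + 1 + 1 = s + 2 by ring]
  push_cast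
  ring

/-! ### The two-particle factor and its gradient. -/

/-- Two points lie in the same cell of the grid of mesh `1/m`. -/
def SameCell (m : ℕ) (x y : Plane) : Prop := ∀ i, ⌊m * x i⌋ = ⌊m * y i⌋

lemma SameCell.symm {m : ℕ} {x y : Plane} (h : SameCell m x y) : SameCell m y x :=
  fun i => (h i).symm

lemma sameCell_comm {m : ℕ} {x y : Plane} : SameCell m x y ↔ SameCell m y x :=
  ⟨SameCell.symm, SameCell.symm⟩

noncomputable instance (m : ℕ) (x y : Plane) : Decidable (SameCell m x y) := by
  unfold SameCell; infer_instance

/-- The logarithm of the Jastrow factor, which correlates only particles in a common cell. -/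
noncomputable def pairLog (α : ℝ) (m : ℕ) (x y : Plane) : ℝ :=
  if SameCell m x y then α * Real.log (m / 2 * ‖x - y‖) else 0

/-- The phase that gauges away the potential between particles in different cells: a branch of the
argument of `x - y` up to sign. -/
noncomputable def pairPhase (α : ℝ) (m : ℕ) (x y : Plane) : ℝ :=
  if ⌊m * x 0⌋ = ⌊m * y 0⌋ then
    if ⌊m * x 1⌋ = ⌊m * y 1⌋ then 0 else α * Real.arctan ((x 0 - y 0) / (x 1 - y 1))
  else -(α * Real.arctan ((x 1 - y 1) / (x 0 - y 0)))

/-- The logarithm of the two-particle factor of the trial state. -/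
noncomputable def pairExponent (α : ℝ) (m : ℕ) (x y : Plane) : ℂ :=
  (pairLog α m x y : ℂ) + (pairPhase α m x y : ℂ) * Complex.I

/-- The gradient of `pairExponent` in its first argument. -/
noncomputable def pairGrad (α : ℝ) (m : ℕ) (x y : Plane) (i : Fin 2) : ℂ :=
  if SameCell m x y then ((α * ((x - y) i / ‖x - y‖ ^ 2) : ℝ) : ℂ)
  else ((-(α * invPerp (x - y) i) : ℝ) : ℂ) * Complex.I

lemma pairLog_comm (α : ℝ) (m : ℕ) (x y : Plane) : pairLog α m x y = pairLog α m y x := by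
  simp [pairLog, sameCell_comm (x := x), norm_sub_rev x y]

/-- The convention `Real.log 0 = 0` makes this hold, so sums over ordered pairs may include the
diagonal. -/
lemma pairLog_self (α : ℝ) (m : ℕ) (x : Plane) : pairLog α m x x = 0 := by simp [pairLog]

lemma pairExponent_self (α : ℝ) (m : ℕ) (x : Plane) : pairExponent α m x x = 0 := by
  simp [pairExponent, pairLog, pairPhase]

lemma pairGrad_self (α : ℝ) (m : ℕ) (x : Plane) (i : Fin 2) : pairGrad α m x x i = 0 := by
  simp [pairGrad, invPerp]

lemma pairGrad_neg (α : ℝ) (m : ℕ) (x y : Plane) (i : Fin 2) :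
    pairGrad α m x y i = -pairGrad α m y x i := by
  have h1 : x - y = -(y - x) := by abel
  have h2 : invPerp (x - y) i = -invPerp (y - x) i := by
    unfold invPerp; rw [norm_sub_rev y x]; fin_cases i <;> simp <;> ring
  have h3 : (x - y) i = -(y - x) i := by rw [h1]; rfl
  unfold pairGrad
  rw [h2, h3, norm_sub_rev x y]
  by_cases h : SameCell m x y
  · rw [if_pos h, if_pos h.symm]; push_cast; ring
  · rw [if_neg h, if_neg fun h' => h h'.symm]; push_cast; ring

/-- The crude diameter `2/m` (instead of `√2/m`) is the one matching the normalization `m/2` in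
`pairLog`, so the Jastrow factor is at most 1. -/
lemma SameCell.norm_sub_lt {m : ℕ} (hm : 1 ≤ m) {x y : Plane} (h : SameCell m x y) :
    ‖x - y‖ < 2 / m := by
  have hm' : (0 : ℝ) < m := by positivity
  have hi : ∀ i, m * |x i - y i| < 1 := fun i => by
    have h1 := Int.abs_sub_lt_one_of_floor_eq_floor (h i)
    rwa [← mul_sub, abs_mul, abs_of_pos hm'] at h1
  rw [lt_div_iff₀ hm', ← abs_of_nonneg (norm_nonneg (x - y)), ← abs_of_nonneg hm'.le, ← abs_mul]
  refine abs_lt_of_sq_lt_sq ?_ (by norm_num)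
  rw [mul_pow, EuclideanSpace.norm_sq_eq, Fin.sum_univ_two]
  simp only [PiLp.sub_apply, Real.norm_eq_abs]
  have h0 : (m * |x 0 - y 0|) ^ 2 ≤ 1 := by
    have := hi 0; exact pow_le_one₀ (by positivity) this.le
  have h1 : (m * |x 1 - y 1|) ^ 2 ≤ 1 := by
    have := hi 1; exact pow_le_one₀ (by positivity) this.le
  nlinarith

lemma pairLog_nonpos {α : ℝ} (hα : 0 ≤ α) {m : ℕ} (hm : 1 ≤ m) (x y : Plane) :
    pairLog α m x y ≤ 0 := by
  unfold pairLog
  split_ifs with h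
  · have hm' : (0 : ℝ) < m := by positivity
    refine mul_nonpos_of_nonneg_of_nonpos hα (Real.log_nonpos (by positivity) ?_)
    have := (h.norm_sub_lt hm).le
    calc (m : ℝ) / 2 * ‖x - y‖ ≤ m / 2 * (2 / m) := by gcongr
      _ = 1 := by field_simp
  · exact le_rfl

lemma floor_eventuallyEq {m : ℕ} {x : Plane} (hx : x ∈ gridInterior m) (i : Fin 2) :
    ∀ᶠ y : Plane in 𝓝 x, ⌊m * y i⌋ = ⌊m * x i⌋ := by
  have hc : Continuous fun y : Plane => m * y i := by fun_prop
  have h1 : (⌊m * x i⌋ : ℝ) < m * x i :=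
    lt_of_le_of_ne (Int.floor_le _) fun h => (hx i).2 _ h.symm
  filter_upwards [hc.continuousAt.eventually (Ioo_mem_nhds h1 (Int.lt_floor_add_one _))] with y hy
  exact Int.floor_eq_iff.mpr ⟨hy.1.le, hy.2⟩

lemma hasFDerivAt_coord (w : Plane) (i : Fin 2) :
    HasFDerivAt (fun y : Plane => y i) (EuclideanSpace.proj i : Plane →L[ℝ] ℝ) w :=
  (EuclideanSpace.proj i : Plane →L[ℝ] ℝ).hasFDerivAt

lemma norm_sq_plane (w : Plane) : ‖w‖ ^ 2 = w 0 ^ 2 + w 1 ^ 2 := by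
  rw [EuclideanSpace.norm_sq_eq, Fin.sum_univ_two]; simp

/-- Up to sign and a locally constant term, `w 1 / w 0` and `w 0 / w 1` both yield the argument of
`w`, each where its denominator is nonzero. Free indices let one formula serve both branches of
`pairPhase`. -/
lemma fderiv_arctan_div {w : Plane} {i j : Fin 2} (h : w j ≠ 0) (v : Plane) :
    ContDiffAt ℝ 1 (fun y : Plane => Real.arctan (y i / y j)) w ∧
    fderiv ℝ (fun y : Plane => Real.arctan (y i / y j)) w v =
      (w j * v i - w i * v j) / (w i ^ 2 + w j ^ 2) := by
  constructor
  · exact Real.contDiff_arctan.contDiffAt.comp w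
      (ContDiffAt.div (by fun_prop) (by fun_prop) h)
  · have h1 := (((hasFDerivAt_coord w i).mul ((hasDerivAt_inv h).comp_hasFDerivAt w
      (hasFDerivAt_coord w j)))).arctan
    have h2 : HasFDerivAt (fun y : Plane => Real.arctan (y i / y j)) _ w :=
      h1.congr_of_eventuallyEq (Eventually.of_forall fun y => by simp [div_eq_mul_inv])
    rw [h2.fderiv]
    have : w i ^ 2 + w j ^ 2 ≠ 0 := by positivity
    have : w j ^ 2 + w i ^ 2 ≠ 0 := by positivity
    simp
    field_simp
    ring

lemma fderiv_log_mul_norm {w : Plane} (h : w ≠ 0) {c : ℝ} (hc : c ≠ 0) (v : Plane) :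
    ContDiffAt ℝ 1 (fun y : Plane => Real.log (c * ‖y‖)) w ∧
    fderiv ℝ (fun y : Plane => Real.log (c * ‖y‖)) w v =
      (w 0 * v 0 + w 1 * v 1) / ‖w‖ ^ 2 := by
  have hw : ‖w‖ ≠ 0 := norm_ne_zero_iff.mpr h
  constructor
  · exact (contDiffAt_const.mul (contDiffAt_norm ℝ h)).log (mul_ne_zero hc hw)
  · have h0 : (fun y : Plane => Real.log (c * ‖y‖)) =ᶠ[𝓝 w]
        fun y => 1 / 2 * Real.log (c ^ 2 * (y 0 * y 0 + y 1 * y 1)) := by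
      refine Eventually.of_forall fun y => ?_
      have : c ^ 2 * (y 0 * y 0 + y 1 * y 1) = (c * ‖y‖) ^ 2 := by
        rw [mul_pow, norm_sq_plane]; ring
      simp only [this, Real.log_pow]; push_cast; ring
    have hs : w 0 * w 0 + w 1 * w 1 ≠ 0 := by
      have := norm_sq_plane w
      have h3 := pow_ne_zero 2 hw
      intro h4; apply h3; rw [this, ← h4]; ring
    have h1 := (((((hasFDerivAt_coord w 0).mul (hasFDerivAt_coord w 0)).add
      ((hasFDerivAt_coord w 1).mul (hasFDerivAt_coord w 1))).const_mul (c ^ 2)).log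
      (mul_ne_zero (pow_ne_zero 2 hc) hs)).const_mul (1 / 2)
    have h2 := h1.congr_of_eventuallyEq h0
    rw [h2.fderiv, norm_sq_plane]
    have : w 0 ^ 2 + w 1 ^ 2 ≠ 0 := by convert hs using 1; ring
    simp
    field_simp
    ring

/-- Near configurations of distinct points off the grid, `pairExponent` is differentiable, with
gradient `pairGrad`. -/
lemma fderiv_pairExponent (α : ℝ) {m : ℕ} (hm : 1 ≤ m) {x y : Plane} (hx : x ∈ gridInterior m)
    (hy : y ∈ gridInterior m) (hxy : x ≠ y) :
    ∃ k : Plane → ℂ, ContDiffAt ℝ 1 k (x - y) ∧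
      (∀ i, fderiv ℝ k (x - y) (EuclideanSpace.single i 1) = pairGrad α m x y i) ∧
      ∀ᶠ p : Plane × Plane in 𝓝 (x, y), pairExponent α m p.1 p.2 = k (p.1 - p.2) := by
  have hev : ∀ i, ∀ᶠ p : Plane × Plane in 𝓝 (x, y),
      ⌊m * p.1 i⌋ = ⌊m * x i⌋ ∧ ⌊m * p.2 i⌋ = ⌊m * y i⌋ := fun i =>
    ((continuous_fst.tendsto (x, y)).eventually (floor_eventuallyEq hx i)).and
      ((continuous_snd.tendsto (x, y)).eventually (floor_eventuallyEq hy i))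
  have hev' := (hev 0).and (hev 1)
  have hm' : (m : ℝ) / 2 ≠ 0 := by positivity
  have hof : ∀ {f : Plane → ℝ} {w : Plane}, ContDiffAt ℝ 1 f w →
      ContDiffAt ℝ 1 (fun z => (f z : ℂ)) w := fun h =>
    Complex.ofRealCLM.contDiff.contDiffAt.comp _ h
  have hofd : ∀ {f : Plane → ℝ} {w : Plane}, ContDiffAt ℝ 1 f w → ∀ v,
      fderiv ℝ (fun z => (f z : ℂ)) w v = ((fderiv ℝ f w v : ℝ) : ℂ) := fun h v => by
    have h1 := Complex.ofRealCLM.hasFDerivAt.comp _ (h.differentiableAt one_ne_zero).hasFDerivAt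
    have h2 := h1.fderiv
    exact congrArg (fun l => l v) h2
  -- In a common cell only the Jastrow logarithm survives. Otherwise the floors differ in some
  -- coordinate, so that coordinate of `x - y` is nonzero and can be the denominator of the
  -- arctangent.
  by_cases h0 : ⌊m * x 0⌋ = ⌊m * y 0⌋
  · by_cases h1 : ⌊m * x 1⌋ = ⌊m * y 1⌋
    · have hs : SameCell m x y := fun i => by fin_cases i <;> assumption
      have hc := fun v => fderiv_log_mul_norm (sub_ne_zero.mpr hxy) hm' v
      have hC : ContDiffAt ℝ 1 (fun w : Plane => α * Real.log (m / 2 * ‖w‖)) (x - y) :=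
        contDiffAt_const.mul (hc 0).1
      refine ⟨fun w => ((α * Real.log (m / 2 * ‖w‖) : ℝ) : ℂ), hof hC, fun i => ?_, ?_⟩
      · rw [hofd hC, fderiv_const_mul ((hc 0).1.differentiableAt one_ne_zero)]
        simp only [_root_.smul_apply, (hc _).2, pairGrad, if_pos hs]
        fin_cases i <;> simp
      · filter_upwards [hev'] with p hp
        obtain ⟨⟨a, b⟩, c, d⟩ := hp
        have hs' : SameCell m p.1 p.2 := fun i => by
          fin_cases i
          · simpa [a, b] using h0
          · simpa [c, d] using h1
        simp only [pairExponent, pairLog, if_pos hs', pairPhase, if_pos (hs' 0), if_pos (hs' 1)]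
        simp
    · have hs : ¬ SameCell m x y := fun h => h1 (h 1)
      have hne : (x - y) 1 ≠ 0 := fun h => h1 (by
        rw [PiLp.sub_apply, sub_eq_zero] at h; rw [h])
      have hc := fun v => fderiv_arctan_div (i := 0) hne v
      have hC : ContDiffAt ℝ 1 (fun w : Plane => α * Real.arctan (w 0 / w 1)) (x - y) :=
        contDiffAt_const.mul (hc 0).1
      refine ⟨fun w => ((α * Real.arctan (w 0 / w 1) : ℝ) : ℂ) * Complex.I,
        (hof hC).mul contDiffAt_const, fun i => ?_, ?_⟩
      · rw [fderiv_mul_const ((hof hC).differentiableAt one_ne_zero)]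
        simp only [_root_.smul_apply, smul_eq_mul]
        rw [hofd hC, fderiv_const_mul ((hc 0).1.differentiableAt one_ne_zero)]
        simp only [_root_.smul_apply, (hc _).2, pairGrad, if_neg hs, invPerp,
          norm_sq_plane]
        rw [mul_comm]
        congr 2
        fin_cases i <;> simp <;> ring
      · filter_upwards [hev'] with p hp
        obtain ⟨⟨a, b⟩, c, d⟩ := hp
        rw [← a, ← b] at h0
        rw [← c, ← d] at h1
        have hs' : ¬ SameCell m p.1 p.2 := fun h => h1 (h 1)
        simp only [pairExponent, pairLog, if_neg hs', pairPhase, if_pos h0, if_neg h1]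
        simp
  · have hs : ¬ SameCell m x y := fun h => h0 (h 0)
    have hne : (x - y) 0 ≠ 0 := fun h => h0 (by
      rw [PiLp.sub_apply, sub_eq_zero] at h; rw [h])
    have hc := fun v => fderiv_arctan_div (i := 1) hne v
    have hC : ContDiffAt ℝ 1 (fun w : Plane => (-α) * Real.arctan (w 1 / w 0)) (x - y) :=
      contDiffAt_const.mul (hc 0).1
    refine ⟨fun w => (((-α) * Real.arctan (w 1 / w 0) : ℝ) : ℂ) * Complex.I,
      (hof hC).mul contDiffAt_const, fun i => ?_, ?_⟩
    · rw [fderiv_mul_const ((hof hC).differentiableAt one_ne_zero)]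
      simp only [_root_.smul_apply, smul_eq_mul]
      rw [hofd hC, fderiv_const_mul ((hc 0).1.differentiableAt one_ne_zero)]
      simp only [_root_.smul_apply, (hc _).2, pairGrad, if_neg hs, invPerp,
        norm_sq_plane]
      rw [mul_comm]
      congr 2
      fin_cases i <;> simp [-mul_eq_mul_left_iff] <;> ring
    · filter_upwards [hev'] with p hp
      obtain ⟨⟨a, b⟩, c, d⟩ := hp
      rw [← a, ← b] at h0
      have hs' : ¬ SameCell m p.1 p.2 := fun h => h0 (h 0)
      simp only [pairExponent, pairLog, if_neg hs', pairPhase, if_neg h0]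
      simp

variable {N : ℕ}

/-! ### The trial state and its magnetic gradient. -/

/-- The logarithm of the correlation factor of the trial state. -/
noncomputable def trialExponent (α : ℝ) (m : ℕ) (x : Config N) : ℂ :=
  (1 / 2) * ∑ a, ∑ b, pairExponent α m (x a) (x b)

/-- The (unnormalized) trial state. -/
noncomputable def trial (α : ℝ) (m : ℕ) (x : Config N) : ℂ :=
  ((∏ j, bump m (x j) : ℝ) : ℂ) * Complex.exp (trialExponent α m x)

/-- The pair interaction that remains in the energy of the trial state. -/
noncomputable def pairRepulsion (α : ℝ) (m : ℕ) (x y : Plane) : ℝ :=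
  if SameCell m x y then α * ‖x - y‖⁻¹ else 0

lemma direction_apply (j a : Fin N) (i : Fin 2) :
    (direction j i : Config N) a = if a = j then EuclideanSpace.single i 1 else 0 := by
  by_cases h : a = j
  · subst h; simp [direction]
  · simp [direction, h]

lemma fderiv_pairExponent_coords (α : ℝ) {m : ℕ} (hm : 1 ≤ m) {x : Config N}
    (hx : x ∈ offDiagonal N) (hg : ∀ j, x j ∈ gridInterior m) (a b : Fin N) :
    ContDiffAt ℝ 1 (fun z : Config N => pairExponent α m (z a) (z b)) x ∧
    ∀ j i, fderiv ℝ (fun z : Config N => pairExponent α m (z a) (z b)) x (direction j i) =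
      pairGrad α m (x a) (x b) i * ((if a = j then 1 else 0) - (if b = j then 1 else 0)) := by
  by_cases hab : a = b
  · subst hab
    simp only [pairExponent_self, pairGrad_self]
    exact ⟨contDiffAt_const, by simp⟩
  obtain ⟨k, hk, hk', hev⟩ := fderiv_pairExponent α hm (hg a) (hg b) (fun h => hab (hx h))
  have hc : Continuous fun z : Config N => (z a, z b) := by fun_prop
  have hev' : (fun z : Config N => pairExponent α m (z a) (z b)) =ᶠ[𝓝 x]
      fun z => k (z a - z b) := (hc.tendsto x).eventually hev
  refine ⟨?_, fun j i => ?_⟩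
  · exact (hk.comp (f := fun z : Config N => z a - z b) x (by fun_prop)).congr_of_eventuallyEq hev'
  · rw [hev'.fderiv_eq]
    have h1 : HasFDerivAt (fun z : Config N => z a - z b)
        ((ContinuousLinearMap.proj a : Config N →L[ℝ] Plane) - ContinuousLinearMap.proj b) x :=
      (ContinuousLinearMap.proj a : Config N →L[ℝ] Plane).hasFDerivAt.sub
        (ContinuousLinearMap.proj b : Config N →L[ℝ] Plane).hasFDerivAt
    have h2 := (hk.differentiableAt one_ne_zero).hasFDerivAt.comp x h1
    have h3 : fderiv ℝ (fun z : Config N => k (z a - z b)) x = _ := h2.fderiv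
    rw [h3]
    simp only [ContinuousLinearMap.comp_apply, _root_.sub_apply,
      ContinuousLinearMap.proj_apply, map_sub, direction_apply]
    rw [← hk' i]
    split_ifs <;> simp

/-- By antisymmetry of `pairGrad`, particle `j` contributes equally as first and as second member of
a pair; the factor `1/2` in `trialExponent` cancels this doubling. -/
lemma fderiv_trialExponent (α : ℝ) {m : ℕ} (hm : 1 ≤ m) {x : Config N}
    (hx : x ∈ offDiagonal N) (hg : ∀ j, x j ∈ gridInterior m) :
    ContDiffAt ℝ 1 (trialExponent α m : Config N → ℂ) x ∧
    ∀ j i, fderiv ℝ (trialExponent α m : Config N → ℂ) x (direction j i) =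
      ∑ b, pairGrad α m (x j) (x b) i := by
  have h := fderiv_pairExponent_coords α hm hx hg
  have hd : ∀ a b, HasFDerivAt (fun z : Config N => pairExponent α m (z a) (z b)) _ x :=
    fun a b => ((h a b).1.differentiableAt one_ne_zero).hasFDerivAt
  refine ⟨contDiffAt_const.mul (ContDiffAt.sum fun a _ => ContDiffAt.sum fun b _ => (h a b).1),
    fun j i => ?_⟩
  have h1 : HasFDerivAt (trialExponent α m : Config N → ℂ) _ x :=
    (HasFDerivAt.fun_sum fun a (_ : a ∈ Finset.univ) =>
      HasFDerivAt.fun_sum fun b (_ : b ∈ Finset.univ) => hd a b).const_mul (1 / 2 : ℂ)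
  rw [h1.fderiv]
  simp only [_root_.smul_apply, _root_.sum_apply, (h _ _).2, smul_eq_mul, mul_sub,
    Finset.sum_sub_distrib]
  have e1 : ∑ a, ∑ b, pairGrad α m (x a) (x b) i * (if a = j then 1 else 0) =
      ∑ b, pairGrad α m (x j) (x b) i := by
    rw [Finset.sum_eq_single j] <;> simp +contextual
  have e2 : ∑ a, ∑ b, pairGrad α m (x a) (x b) i * (if b = j then 1 else 0) =
      -∑ b, pairGrad α m (x j) (x b) i := by
    rw [← Finset.sum_neg_distrib]
    refine Finset.sum_congr rfl fun a _ => ?_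
    rw [← pairGrad_neg, Finset.sum_eq_single j] <;> simp +contextual
  rw [e1, e2]; ring

lemma contDiff_prod_bump (m : ℕ) : ContDiff ℝ 1 fun x : Config N => ∏ j, bump m (x j) :=
  contDiff_prod fun j _ => (contDiff_bump m).comp (by fun_prop)

lemma fderiv_prod_bump (m : ℕ) (x : Config N) (j : Fin N) (i : Fin 2) :
    fderiv ℝ (fun x : Config N => ∏ j, bump m (x j)) x (direction j i) =
      (∏ l ∈ Finset.univ.erase j, bump m (x l)) *
        fderiv ℝ (bump m) (x j) (EuclideanSpace.single i 1) := by
  have h1 : ∀ l, HasFDerivAt (fun z : Config N => bump m (z l))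
      ((fderiv ℝ (bump m) (x l)).comp (ContinuousLinearMap.proj l : Config N →L[ℝ] Plane)) x :=
    fun l => HasFDerivAt.comp (g := bump m) x
      (((contDiff_bump m).differentiable one_ne_zero).differentiableAt (x := x l)).hasFDerivAt
      (ContinuousLinearMap.proj l : Config N →L[ℝ] Plane).hasFDerivAt
  have h2 := HasFDerivAt.finsetProd (u := Finset.univ) (fun l _ => h1 l)
  rw [h2.fderiv]
  simp only [_root_.sum_apply, _root_.smul_apply, ContinuousLinearMap.comp_apply,
    ContinuousLinearMap.proj_apply, direction_apply, smul_eq_mul]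
  rw [Finset.sum_eq_single j] <;> simp +contextual

lemma trial_eventually_zero (α : ℝ) {m : ℕ} {x : Config N} {j : Fin N}
    (hj : x j ∉ gridInterior m) : (trial α m : Config N → ℂ) =ᶠ[𝓝 x] 0 := by
  have hc : Continuous fun z : Config N => z j := by fun_prop
  filter_upwards [(hc.tendsto x).eventually (bump_eventually_zero hj)] with z hz
  have : ∏ j, bump m (z j) = 0 := Finset.prod_eq_zero (Finset.mem_univ j) hz
  simp [trial, this]

lemma fderiv_trial (α : ℝ) {m : ℕ} (hm : 1 ≤ m) {x : Config N}
    (hx : x ∈ offDiagonal N) (hg : ∀ j, x j ∈ gridInterior m) :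
    ContDiffAt ℝ 1 (trial α m : Config N → ℂ) x ∧
    ∀ j i, fderiv ℝ (trial α m : Config N → ℂ) x (direction j i) =
      Complex.exp (trialExponent α m x) *
        ((((∏ l ∈ Finset.univ.erase j, bump m (x l)) *
          fderiv ℝ (bump m) (x j) (EuclideanSpace.single i 1) : ℝ) : ℂ) +
        ((∏ l, bump m (x l) : ℝ) : ℂ) * ∑ b, pairGrad α m (x j) (x b) i) := by
  obtain ⟨h1, h2⟩ := fderiv_trialExponent α hm hx hg
  have h3 := (contDiff_prod_bump (N := N) m).contDiffAt (x := x)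
  refine ⟨(Complex.ofRealCLM.contDiff.contDiffAt.comp x h3).mul h1.cexp, fun j i => ?_⟩
  have h4 := Complex.ofRealCLM.hasFDerivAt.comp x (h3.differentiableAt one_ne_zero).hasFDerivAt
  have h5 : HasFDerivAt (trial α m : Config N → ℂ) _ x :=
    h4.mul (h1.differentiableAt one_ne_zero).hasFDerivAt.cexp
  rw [h5.fderiv]
  simp only [_root_.add_apply, _root_.smul_apply, ContinuousLinearMap.comp_apply,
    h2, fderiv_prod_bump, smul_eq_mul, Function.comp_apply, Complex.ofRealCLM_apply]
  ring

/-- Jumps of the cell indices do no harm, since the amplitude vanishes in a neighbourhood of them.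
Only the diagonals, where the Jastrow factor is singular, must be excluded. -/
lemma contDiffAt_trial (α : ℝ) {m : ℕ} (hm : 1 ≤ m) {x : Config N}
    (hx : x ∈ offDiagonal N) : ContDiffAt ℝ 1 (trial α m : Config N → ℂ) x := by
  by_cases hg : ∀ j, x j ∈ gridInterior m
  · exact (fderiv_trial α hm hx hg).1
  · push Not at hg
    obtain ⟨j, hj⟩ := hg
    exact contDiffAt_const.congr_of_eventuallyEq (trial_eventually_zero α hj)

lemma abs_invPerp_le (w : Plane) (i : Fin 2) : |invPerp w i| ≤ ‖w‖⁻¹ := by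
  have h : ∀ j, |w j| ≤ ‖w‖ := fun j => by
    simpa using PiLp.norm_apply_le w j
  have key : ∀ j, (‖w‖ ^ 2)⁻¹ * |w j| ≤ ‖w‖⁻¹ := fun j => by
    rcases eq_or_ne ‖w‖ 0 with h0 | h0
    · simp [h0]
    · calc (‖w‖ ^ 2)⁻¹ * |w j| ≤ (‖w‖ ^ 2)⁻¹ * ‖w‖ := by gcongr; exact h j
        _ = ‖w‖⁻¹ := by field_simp
  unfold invPerp
  fin_cases i
  · simpa [abs_mul] using key 1
  · simpa [abs_mul] using key 0

lemma abs_apply_div_norm_sq_le (w : Plane) (i : Fin 2) : |w i / ‖w‖ ^ 2| ≤ ‖w‖⁻¹ := by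
  have h : |w i| ≤ ‖w‖ := by simpa using PiLp.norm_apply_le w i
  rw [abs_div, abs_of_nonneg (sq_nonneg ‖w‖)]
  rcases eq_or_ne ‖w‖ 0 with h0 | h0
  · simp [h0]
  · calc |w i| / ‖w‖ ^ 2 ≤ ‖w‖ / ‖w‖ ^ 2 := by gcongr
      _ = ‖w‖⁻¹ := by field_simp

/-- In different cells the gradient of the phase cancels the potential exactly. In a common cell the
logarithmic gradient and the potential are each at most `α/r`, whence the factor 2. -/
lemma norm_pairGrad_add_le {α : ℝ} (hα : 0 ≤ α) (m : ℕ) (x y : Plane) (i : Fin 2) :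
    ‖-Complex.I * pairGrad α m x y i + (α : ℂ) * ((invPerp (x - y) i : ℝ) : ℂ)‖ ≤
      2 * pairRepulsion α m x y := by
  unfold pairGrad pairRepulsion
  split_ifs with h
  · refine (norm_add_le _ _).trans ?_
    have h1 := abs_invPerp_le (x - y) i
    have h2 := abs_apply_div_norm_sq_le (x - y) i
    simp only [norm_mul, norm_neg, Complex.norm_I, Complex.norm_real, Real.norm_eq_abs, one_mul,
      abs_of_nonneg hα]
    nlinarith
  · have : -Complex.I * (((-(α * invPerp (x - y) i) : ℝ) : ℂ) * Complex.I) =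
        (Complex.I * Complex.I) * ((α : ℂ) * ((invPerp (x - y) i : ℝ) : ℂ)) := by
      push_cast; ring
    rw [this, Complex.I_mul_I]; simp

lemma trialExponent_re (α : ℝ) (m : ℕ) (x : Config N) :
    (trialExponent α m x).re = 1 / 2 * ∑ a, ∑ b, pairLog α m (x a) (x b) := by
  have h1 : ∀ x y, (pairExponent α m x y).re = pairLog α m x y := fun x y => by
    simp [pairExponent]
  have h2 : (1 / 2 : ℂ) = ((1 / 2 : ℝ) : ℂ) := by push_cast; rfl
  rw [trialExponent, h2, Complex.re_ofReal_mul, Complex.re_sum]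
  simp only [Complex.re_sum, h1]

/-- The magnetic gradient of the trial state. -/
noncomputable def trialGrad (α : ℝ) (m : ℕ) (j : Fin N) (i : Fin 2) : Config N → ℂ :=
  (offDiagonal N).indicator fun x => -Complex.I * fderiv ℝ (trial α m) x (direction j i) +
    (α : ℂ) * ((vecPot j x i : ℝ) : ℂ) * trial α m x

lemma norm_trialGrad_le {α : ℝ} (hα : 0 ≤ α) {m : ℕ} (hm : 1 ≤ m) (j : Fin N) (i : Fin 2)
    (x : Config N) :
    ‖trialGrad α m j i x‖ ≤ Real.exp (1 / 2 * ∑ a, ∑ b, pairLog α m (x a) (x b)) *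
      ((∏ l ∈ Finset.univ.erase j, bump m (x l)) *
        |fderiv ℝ (bump m) (x j) (EuclideanSpace.single i 1)| +
      (∏ l, bump m (x l)) * (2 * ∑ k ∈ Finset.univ.erase j, pairRepulsion α m (x j) (x k))) := by
  have hu : ∀ x y, 0 ≤ pairRepulsion α m x y := fun x y => by
    unfold pairRepulsion; split_ifs <;> positivity
  have hP : ∀ s : Finset (Fin N), 0 ≤ ∏ l ∈ s, bump m (x l) := fun s =>
    Finset.prod_nonneg fun _ _ => bump_nonneg _ _
  have h0 : 0 ≤ Real.exp (1 / 2 * ∑ a, ∑ b, pairLog α m (x a) (x b)) *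
      ((∏ l ∈ Finset.univ.erase j, bump m (x l)) *
        |fderiv ℝ (bump m) (x j) (EuclideanSpace.single i 1)| +
      (∏ l, bump m (x l)) * (2 * ∑ k ∈ Finset.univ.erase j, pairRepulsion α m (x j) (x k))) := by
    have := hP (Finset.univ.erase j)
    have := hP Finset.univ
    have := Finset.sum_nonneg fun k (_ : k ∈ Finset.univ.erase j) => hu (x j) (x k)
    positivity
  by_cases hx : x ∈ offDiagonal N
  swap
  · rw [trialGrad, Set.indicator_of_notMem hx, norm_zero]; exact h0
  rw [trialGrad, Set.indicator_of_mem hx]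
  by_cases hg : ∀ j, x j ∈ gridInterior m
  swap
  · push Not at hg
    obtain ⟨l, hl⟩ := hg
    have hz := trial_eventually_zero α hl
    rw [hz.fderiv_eq, hz.eq_of_nhds]
    simpa using h0
  rw [(fderiv_trial α hm hx hg).2]
  have hv : ((vecPot j x i : ℝ) : ℂ) =
      ∑ k ∈ Finset.univ.erase j, ((invPerp (x j - x k) i : ℝ) : ℂ) := by
    rw [vecPot]; simp
  have hs : ∑ b, pairGrad α m (x j) (x b) i =
      ∑ b ∈ Finset.univ.erase j, pairGrad α m (x j) (x b) i :=
    (Finset.sum_erase (f := fun b => pairGrad α m (x j) (x b) i) _ (pairGrad_self α m (x j) i)).symm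
  rw [hv, hs, trial]
  -- Matches each summand of the vector potential with the gradient of the exponent for the same
  -- pair, so that the cancellation applies term by term.
  have key : ∀ (e p q : ℂ) (f g : Fin N → ℂ),
      -Complex.I * (e * (p + q * ∑ b ∈ Finset.univ.erase j, f b)) +
        (α : ℂ) * (∑ b ∈ Finset.univ.erase j, g b) * (q * e) =
      e * (-Complex.I * p +
        q * ∑ b ∈ Finset.univ.erase j, (-Complex.I * f b + (α : ℂ) * g b)) := by
    intro e p q f g
    rw [Finset.sum_add_distrib, ← Finset.mul_sum, ← Finset.mul_sum]; ring
  rw [key, norm_mul, Complex.norm_exp, trialExponent_re]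
  gcongr
  refine (norm_add_le _ _).trans (add_le_add ?_ ?_)
  · rw [norm_mul, norm_neg, Complex.norm_I, one_mul, Complex.norm_real, Real.norm_eq_abs, abs_mul,
      abs_of_nonneg (hP _)]
  · rw [norm_mul, Complex.norm_real, Real.norm_eq_abs, abs_of_nonneg (hP _), Finset.mul_sum _ _ 2]
    gcongr
    · exact hP _
    · exact (norm_sum_le _ _).trans (Finset.sum_le_sum fun k _ => norm_pairGrad_add_le hα m _ _ i)

/-! ### Measurability of the ingredients. -/

section Measurability

lemma measurable_floor_coord (m : ℕ) (i : Fin 2) : Measurable fun x : Plane => ⌊m * x i⌋ :=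
  Int.measurable_floor.comp (by fun_prop)

lemma measurableSet_floor_eq (m : ℕ) (i : Fin 2) :
    MeasurableSet {p : Plane × Plane | ⌊m * p.1 i⌋ = ⌊m * p.2 i⌋} :=
  measurableSet_eq_fun ((measurable_floor_coord m i).comp measurable_fst)
    ((measurable_floor_coord m i).comp measurable_snd)

lemma measurableSet_sameCell (m : ℕ) : MeasurableSet {p : Plane × Plane | SameCell m p.1 p.2} := by
  have : {p : Plane × Plane | SameCell m p.1 p.2} =
      ⋂ i, {p : Plane × Plane | ⌊m * p.1 i⌋ = ⌊m * p.2 i⌋} := by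
    ext p; simp [SameCell]
  rw [this]
  exact MeasurableSet.iInter fun i => measurableSet_floor_eq m i

lemma measurable_pairLog (α : ℝ) (m : ℕ) :
    Measurable fun p : Plane × Plane => pairLog α m p.1 p.2 :=
  Measurable.ite (measurableSet_sameCell m) (by fun_prop) measurable_const

lemma measurable_pairRepulsion (α : ℝ) (m : ℕ) :
    Measurable fun p : Plane × Plane => pairRepulsion α m p.1 p.2 :=
  Measurable.ite (measurableSet_sameCell m) (by fun_prop) measurable_const

lemma measurable_pairPhase (α : ℝ) (m : ℕ) :
    Measurable fun p : Plane × Plane => pairPhase α m p.1 p.2 :=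
  Measurable.ite (measurableSet_floor_eq m 0)
    (Measurable.ite (measurableSet_floor_eq m 1) measurable_const
      ((Real.measurable_arctan.comp (by fun_prop)).const_mul _))
    ((Real.measurable_arctan.comp (by fun_prop)).const_mul _).neg

lemma measurable_pairLog_coords (α : ℝ) (m : ℕ) (a b : Fin N) :
    Measurable fun x : Config N => pairLog α m (x a) (x b) :=
  (measurable_pairLog α m).comp (by fun_prop : Measurable fun x : Config N => (x a, x b))

lemma measurable_pairRepulsion_coords (α : ℝ) (m : ℕ) (a b : Fin N) :
    Measurable fun x : Config N => pairRepulsion α m (x a) (x b) :=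
  (measurable_pairRepulsion α m).comp (by fun_prop : Measurable fun x : Config N => (x a, x b))

lemma measurable_pairPhase_coords (α : ℝ) (m : ℕ) (a b : Fin N) :
    Measurable fun x : Config N => pairPhase α m (x a) (x b) :=
  (measurable_pairPhase α m).comp (by fun_prop : Measurable fun x : Config N => (x a, x b))

lemma measurable_bump (m : ℕ) : Measurable (bump m) := (contDiff_bump m).continuous.measurable

lemma measurable_bump_coords (m : ℕ) (a : Fin N) :
    Measurable fun x : Config N => bump m (x a) :=
  (measurable_bump m).comp (by fun_prop)

lemma measurable_prod_bump (m : ℕ) (s : Finset (Fin N)) :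
    Measurable fun x : Config N => ∏ j ∈ s, bump m (x j) :=
  Finset.measurable_fun_prod _ fun j _ => measurable_bump_coords m j

lemma measurable_trial (α : ℝ) (m : ℕ) : Measurable (trial α m : Config N → ℂ) := by
  refine (Complex.measurable_ofReal.comp (measurable_prod_bump m _)).mul
    (Complex.measurable_exp.comp (Measurable.const_mul
      (Finset.measurable_fun_sum _ fun a _ => Finset.measurable_fun_sum _ fun b _ => ?_) _))
  exact (Complex.measurable_ofReal.comp (measurable_pairLog_coords α m a b)).add
    ((Complex.measurable_ofReal.comp (measurable_pairPhase_coords α m a b)).mul_const _)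

end Measurability

/-! ### Integrals of the pair interaction over one particle. -/

lemma pairRepulsion_comm (α : ℝ) (m : ℕ) (x y : Plane) :
    pairRepulsion α m x y = pairRepulsion α m y x := by
  simp [pairRepulsion, sameCell_comm (x := x), norm_sub_rev x y]

lemma pairRepulsion_nonneg {α : ℝ} (hα : 0 ≤ α) (m : ℕ) (x y : Plane) :
    0 ≤ pairRepulsion α m x y := by
  unfold pairRepulsion; split_ifs <;> positivity

/-- The length of the unit circle. -/
noncomputable def circleLength : ℝ := 2 * (volume : Measure Plane).real (Metric.ball 0 1)

lemma circleLength_pos : 0 < circleLength :=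
  mul_pos two_pos (ENNReal.toReal_pos (Metric.measure_ball_pos _ _ one_pos).ne'
    measure_ball_lt_top.ne)

/-- Points of a common cell lie in a disk of radius `2/m`, over which `1/r` integrates to the length
of the unit circle times the radius. -/
lemma lintegral_pairRepulsion_le {α : ℝ} (hα : 0 ≤ α) {m : ℕ} (hm : 1 ≤ m) (y : Plane) :
    ∫⁻ t, ENNReal.ofReal (pairRepulsion α m t y) ≤
      ENNReal.ofReal (α * (circleLength * (2 / m))) := by
  have hm' : (0 : ℝ) < m := by positivity
  have h : ∀ t, ENNReal.ofReal (pairRepulsion α m t y) ≤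
      ENNReal.ofReal α * (Metric.ball y (2 / m)).indicator
        (fun t => ENNReal.ofReal (‖t - y‖ ^ (-1 : ℝ))) t := fun t => by
    unfold pairRepulsion
    split_ifs with h
    · have : t ∈ Metric.ball y (2 / m) := by
        rw [Metric.mem_ball, dist_eq_norm]; exact h.norm_sub_lt hm
      rw [Set.indicator_of_mem this, Real.rpow_neg_one, ENNReal.ofReal_mul hα]
    · simp
  calc _ ≤ _ := lintegral_mono h
    _ = ENNReal.ofReal α * ∫⁻ t in Metric.ball y (2 / m), ENNReal.ofReal (‖t - y‖ ^ (-1 : ℝ)) := by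
        rw [lintegral_const_mul' _ _ ENNReal.ofReal_ne_top,
          lintegral_indicator Metric.isOpen_ball.measurableSet]
    _ ≤ _ := by
        rw [lintegral_ball_rpow (by norm_num) (by positivity), ← ENNReal.ofReal_mul hα,
          ← circleLength]
        norm_num

/-- The weight `(m r / 2)^(2α)` makes `α²/r²` integrable. The radial integral of `r^(2α-1)` brings a
factor `1/(2α)`, leaving one power of `α`, and the powers of `m` cancel. This is the source of the
linear dependence on `α`. -/
lemma lintegral_pairRepulsion_sq_le {α : ℝ} (hα : 0 ≤ α) {m : ℕ} (hm : 1 ≤ m) (y : Plane) :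
    ∫⁻ t, ENNReal.ofReal (Real.exp (2 * pairLog α m t y) * pairRepulsion α m t y ^ 2) ≤
      ENNReal.ofReal (circleLength * α) := by
  have hm' : (0 : ℝ) < m := by positivity
  -- At `α = 0` the power `2α - 2 = -2` is not integrable, but the integrand is zero.
  rcases hα.eq_or_lt with rfl | hα'
  · simp [pairRepulsion]
  have h : ∀ t, ENNReal.ofReal (Real.exp (2 * pairLog α m t y) * pairRepulsion α m t y ^ 2) ≤
      ENNReal.ofReal (α ^ 2 * (m / 2) ^ (2 * α)) * (Metric.ball y (2 / m)).indicator
        (fun t => ENNReal.ofReal (‖t - y‖ ^ (2 * α - 2))) t := fun t => by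
    unfold pairRepulsion
    split_ifs with h
    · have hmem : t ∈ Metric.ball y (2 / m) := by
        rw [Metric.mem_ball, dist_eq_norm]; exact h.norm_sub_lt hm
      rw [Set.indicator_of_mem hmem, ← ENNReal.ofReal_mul (by positivity)]
      apply ENNReal.ofReal_le_ofReal
      rcases eq_or_ne t y with rfl | hne
      · simp only [sub_self, norm_zero, inv_zero, mul_zero, zero_pow two_ne_zero]
        positivity
      · have hr : 0 < ‖t - y‖ := norm_pos_iff.mpr (sub_ne_zero.mpr hne)
        have he : Real.exp (2 * pairLog α m t y) = (m / 2) ^ (2 * α) * ‖t - y‖ ^ (2 * α) := by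
          rw [pairLog, if_pos h, ← Real.mul_rpow (by positivity) hr.le,
            Real.rpow_def_of_pos (by positivity)]
          congr 1; ring
        rw [he, Real.rpow_sub hr, Real.rpow_two]
        apply le_of_eq; field_simp
    · simp
  calc _ ≤ _ := lintegral_mono h
    _ = ENNReal.ofReal (α ^ 2 * (m / 2) ^ (2 * α)) *
        ∫⁻ t in Metric.ball y (2 / m), ENNReal.ofReal (‖t - y‖ ^ (2 * α - 2)) := by
        rw [lintegral_const_mul' _ _ ENNReal.ofReal_ne_top,
          lintegral_indicator Metric.isOpen_ball.measurableSet]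
    _ ≤ _ := by
        rw [lintegral_ball_rpow (by linarith) (by positivity),
          ← ENNReal.ofReal_mul (by positivity), ← circleLength]
        apply ENNReal.ofReal_le_ofReal
        have h1 : ((m : ℝ) / 2) ^ (2 * α) * (2 / m) ^ (2 * α) = 1 := by
          rw [← Real.mul_rpow (by positivity) (by positivity)]
          have : (m : ℝ) / 2 * (2 / m) = 1 := by field_simp
          rw [this, Real.one_rpow]
        have h2 : 2 * α - 2 + 2 = 2 * α := by ring
        have h3 : α ^ 2 * ((m : ℝ) / 2) ^ (2 * α) *
            (circleLength * ((2 / m) ^ (2 * α) / (2 * α))) = circleLength * α / 2 *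
              (((m : ℝ) / 2) ^ (2 * α) * (2 / m) ^ (2 * α)) := by
          field_simp
        rw [h2, h3, h1]
        nlinarith [mul_pos circleLength_pos hα']

/-- This is `log z ≥ 1 - 1/z` at `z = m r / 2`. The bound on the integral of `1/r` then also
controls the mass removed by the Jastrow factors. -/
lemma neg_pairLog_le {α : ℝ} (hα : 0 ≤ α) {m : ℕ} (hm : 1 ≤ m) (x y : Plane) :
    -pairLog α m x y ≤ 2 / m * pairRepulsion α m x y := by
  have hm' : (0 : ℝ) < m := by positivity
  unfold pairLog pairRepulsion
  split_ifs with h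
  · rcases eq_or_ne x y with rfl | hne
    · simp
    · have hr : 0 < ‖x - y‖ := norm_pos_iff.mpr (sub_ne_zero.mpr hne)
      have h1 := Real.one_sub_inv_le_log_of_pos (x := m / 2 * ‖x - y‖) (by positivity)
      have h2 : (m / 2 * ‖x - y‖)⁻¹ = 2 / m * ‖x - y‖⁻¹ := by field_simp
      rw [h2] at h1
      have h3 : -Real.log (m / 2 * ‖x - y‖) ≤ 2 / m * ‖x - y‖⁻¹ := by linarith
      nlinarith [mul_le_mul_of_nonneg_left h3 hα]
  · simp

/-! ### Conditional densities and integrating out one particle. -/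

/-- The correlation of a particle at `t` with all particles of `x` but the `l`-th. -/
noncomputable def corr (α : ℝ) (m : ℕ) (l : Fin N) (x : Config N) (t : Plane) : ℝ :=
  Real.exp (2 * ∑ k ∈ Finset.univ.erase l, pairLog α m t (x k))

lemma corr_pos (α : ℝ) (m : ℕ) (l : Fin N) (x : Config N) (t : Plane) : 0 < corr α m l x t :=
  Real.exp_pos _

/-- Every Jastrow factor is at most 1 and may be dropped; the one for `k` is kept because it tames
`1/r²` near `x k`. -/
lemma corr_le {α : ℝ} (hα : 0 ≤ α) {m : ℕ} (hm : 1 ≤ m) {l k : Fin N} (hk : k ≠ l) (x : Config N)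
    (t : Plane) : corr α m l x t ≤ Real.exp (2 * pairLog α m t (x k)) := by
  refine Real.exp_le_exp.mpr (mul_le_mul_of_nonneg_left ?_ two_pos.le)
  rw [← Finset.add_sum_erase _ _ (Finset.mem_erase.mpr ⟨hk, Finset.mem_univ k⟩)]
  have := Finset.sum_nonpos fun b (_ : b ∈ (Finset.univ.erase l).erase k) =>
    pairLog_nonpos hα hm t (x b)
  linarith

lemma corr_le_one {α : ℝ} (hα : 0 ≤ α) {m : ℕ} (hm : 1 ≤ m) (l : Fin N) (x : Config N)
    (t : Plane) : corr α m l x t ≤ 1 := by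
  refine Real.exp_le_one_iff.mpr ?_
  have := Finset.sum_nonpos fun b (_ : b ∈ Finset.univ.erase l) => pairLog_nonpos hα hm t (x b)
  linarith

/-- The conditional mass of a single particle is bounded below. -/
lemma lintegral_bump_mul_corr_ge {α : ℝ} (hα : 0 ≤ α) {m : ℕ} (hm : 1 ≤ m) {c : ℝ} (hc : 0 < c)
    (hb : ∫⁻ t, ENNReal.ofReal (bump m t ^ 2) = ENNReal.ofReal c)
    (hN : 16 * circleLength * α * N ≤ c * m ^ 2) (l : Fin N) (x : Config N) :
    ENNReal.ofReal (c / 2) ≤ ∫⁻ t, ENNReal.ofReal (bump m t ^ 2 * corr α m l x t) := by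
  have hm' : (0 : ℝ) < m := by positivity
  have hu := fun t k => pairRepulsion_nonneg hα m t (x k)
  have h1 : ∀ t, ENNReal.ofReal (bump m t ^ 2) ≤
      ENNReal.ofReal (bump m t ^ 2 * corr α m l x t) +
        ENNReal.ofReal (2 * (2 / m)) * ∑ k ∈ Finset.univ.erase l,
          ENNReal.ofReal (pairRepulsion α m t (x k)) := fun t => by
    rw [← ENNReal.ofReal_sum_of_nonneg fun k _ => hu t k, ← ENNReal.ofReal_mul (by positivity)]
    have hs := Finset.sum_nonneg fun k (_ : k ∈ Finset.univ.erase l) => hu t k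
    rw [← ENNReal.ofReal_add (mul_nonneg (sq_nonneg _) (corr_pos α m l x t).le) (by positivity)]
    apply ENNReal.ofReal_le_ofReal
    -- Linearizing the exponential bounds the lost mass by a sum of one contribution per other
    -- particle.
    have h2 := Real.add_one_le_exp (2 * ∑ k ∈ Finset.univ.erase l, pairLog α m t (x k))
    have h3 : -∑ k ∈ Finset.univ.erase l, pairLog α m t (x k) ≤
        2 / m * ∑ k ∈ Finset.univ.erase l, pairRepulsion α m t (x k) := by
      rw [← Finset.sum_neg_distrib, Finset.mul_sum]
      exact Finset.sum_le_sum fun k _ => neg_pairLog_le hα hm t (x k)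
    have h4 : bump m t ^ 2 ≤ 1 := pow_le_one₀ (bump_nonneg _ _) (bump_le_one _ _)
    have h5 := sq_nonneg (bump m t)
    change bump m t ^ 2 ≤ bump m t ^ 2 * Real.exp _ + _
    set Y := ∑ k ∈ Finset.univ.erase l, pairLog α m t (x k)
    set U := 2 / m * ∑ k ∈ Finset.univ.erase l, pairRepulsion α m t (x k)
    have hU : 0 ≤ U := by positivity
    have h6 : bump m t ^ 2 * (2 * Y + 1) ≤ bump m t ^ 2 * Real.exp (2 * Y) := by gcongr
    have h7 : bump m t ^ 2 * (-(2 * Y)) ≤ 2 * U := by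
      calc bump m t ^ 2 * (-(2 * Y)) ≤ bump m t ^ 2 * (2 * U) := by gcongr; linarith
        _ ≤ 1 * (2 * U) := by gcongr
        _ = _ := one_mul _
    have h8 : 2 * (2 / (m : ℝ)) * ∑ k ∈ Finset.univ.erase l, pairRepulsion α m t (x k) = 2 * U := by
      simp only [U]; ring
    rw [h8]
    nlinarith
  have hmeas : ∀ k, Measurable fun t => ENNReal.ofReal (pairRepulsion α m t (x k)) := fun k =>
    ((measurable_pairRepulsion α m).comp (by fun_prop : Measurable fun t : Plane =>
      (t, x k))).ennreal_ofReal
  have h2 : ENNReal.ofReal c ≤ (∫⁻ t, ENNReal.ofReal (bump m t ^ 2 * corr α m l x t)) +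
      ENNReal.ofReal (c / 2) := by
    calc ENNReal.ofReal c = _ := hb.symm
      _ ≤ _ := lintegral_mono h1
      _ = (∫⁻ t, ENNReal.ofReal (bump m t ^ 2 * corr α m l x t)) +
          ENNReal.ofReal (2 * (2 / m)) * ∑ k ∈ Finset.univ.erase l,
            ∫⁻ t, ENNReal.ofReal (pairRepulsion α m t (x k)) := by
          rw [lintegral_add_right _
            ((Finset.measurable_fun_sum _ fun k _ => hmeas k).const_mul _),
            lintegral_const_mul' _ _ ENNReal.ofReal_ne_top,
            lintegral_finsetSum _ fun k _ => hmeas k]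
      _ ≤ (∫⁻ t, ENNReal.ofReal (bump m t ^ 2 * corr α m l x t)) +
          ENNReal.ofReal (2 * (2 / m)) * ∑ k : Fin N,
            ENNReal.ofReal (α * (circleLength * (2 / m))) := by
          gcongr
          refine (Finset.sum_le_sum fun k _ => lintegral_pairRepulsion_le hα hm (x k)).trans ?_
          exact Finset.sum_le_sum_of_subset (Finset.erase_subset _ _)
      _ ≤ _ := by
          gcongr
          rw [Finset.sum_const, Finset.card_univ, Fintype.card_fin, nsmul_eq_mul,
            ← ENNReal.ofReal_natCast, ← ENNReal.ofReal_mul (by positivity),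
            ← ENNReal.ofReal_mul (by positivity)]
          apply ENNReal.ofReal_le_ofReal
          -- The total loss is `8 * circleLength * α * N / m²`, and the constant 16 in `hN` makes
          -- this at most `c / 2`.
          have : 2 * (2 / (m : ℝ)) * (N * (α * (circleLength * (2 / m)))) =
            16 * circleLength * α * N / (2 * m ^ 2) := by field_simp; ring
          rw [this, div_le_div_iff₀ (by positivity) two_pos]
          nlinarith
  have h3 : ENNReal.ofReal c = ENNReal.ofReal (c / 2) + ENNReal.ofReal (c / 2) := by
    rw [← ENNReal.ofReal_add (by positivity) (by positivity)]; congr 1; ring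
  rw [h3] at h2
  exact (ENNReal.add_le_add_iff_right ENNReal.ofReal_ne_top).mp h2

/-- The density of all particles of `x` but the `l`-th. -/
noncomputable def restDensity (α : ℝ) (m : ℕ) (l : Fin N) (x : Config N) : ℝ :=
  (∏ k ∈ Finset.univ.erase l, bump m (x k)) ^ 2 *
    Real.exp (∑ a ∈ Finset.univ.erase l, ∑ b ∈ Finset.univ.erase l, pairLog α m (x a) (x b))

lemma restDensity_nonneg (α : ℝ) (m : ℕ) (l : Fin N) (x : Config N) : 0 ≤ restDensity α m l x :=
  mul_nonneg (sq_nonneg _) (Real.exp_pos _).le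

lemma restDensity_update (α : ℝ) (m : ℕ) (l : Fin N) (x : Config N) (t : Plane) :
    restDensity α m l (Function.update x l t) = restDensity α m l x := by
  have h : ∀ k ∈ Finset.univ.erase l, Function.update x l t k = x k := fun k hk =>
    Function.update_of_ne (Finset.ne_of_mem_erase hk) _ _
  unfold restDensity
  congr 2
  · exact Finset.prod_congr rfl fun k hk => by rw [h k hk]
  · exact Finset.sum_congr rfl fun a ha => Finset.sum_congr rfl fun b hb => by rw [h a ha, h b hb]

lemma corr_update (α : ℝ) (m : ℕ) (l : Fin N) (x : Config N) (s t : Plane) :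
    corr α m l (Function.update x l s) t = corr α m l x t := by
  unfold corr
  congr 2
  exact Finset.sum_congr rfl fun k hk => by
    rw [Function.update_of_ne (Finset.ne_of_mem_erase hk)]

lemma sum_pairLog_eq (α : ℝ) (m : ℕ) (l : Fin N) (x : Config N) :
    ∑ a, ∑ b, pairLog α m (x a) (x b) =
      ∑ a ∈ Finset.univ.erase l, ∑ b ∈ Finset.univ.erase l, pairLog α m (x a) (x b) +
        2 * ∑ k ∈ Finset.univ.erase l, pairLog α m (x l) (x k) := by
  rw [← Finset.add_sum_erase _ _ (Finset.mem_univ l)]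
  have h : ∀ a, ∑ b, pairLog α m (x a) (x b) =
      pairLog α m (x a) (x l) + ∑ b ∈ Finset.univ.erase l, pairLog α m (x a) (x b) := fun a =>
    (Finset.add_sum_erase _ _ (Finset.mem_univ l)).symm
  simp only [h, Finset.sum_add_distrib, pairLog_self]
  rw [Finset.sum_congr rfl fun a _ => pairLog_comm α m (x a) (x l)]
  ring

/-- The density `|Ψ|²` of the trial state. -/
noncomputable def density (α : ℝ) (m : ℕ) (x : Config N) : ℝ :=
  (∏ k, bump m (x k)) ^ 2 * Real.exp (∑ a, ∑ b, pairLog α m (x a) (x b))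

lemma density_nonneg (α : ℝ) (m : ℕ) (x : Config N) : 0 ≤ density α m x :=
  mul_nonneg (sq_nonneg _) (Real.exp_pos _).le

/-- The amplitude of particle `l` is left out because `bumpEnergy` has its derivative in that place.
-/
lemma exp_sum_pairLog (α : ℝ) (m : ℕ) (l : Fin N) (x : Config N) :
    (∏ k ∈ Finset.univ.erase l, bump m (x k)) ^ 2 *
      Real.exp (∑ a, ∑ b, pairLog α m (x a) (x b)) =
      restDensity α m l x * corr α m l x (x l) := by
  rw [sum_pairLog_eq α m l, Real.exp_add, restDensity, corr, mul_assoc]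

lemma density_eq (α : ℝ) (m : ℕ) (l : Fin N) (x : Config N) :
    density α m x = restDensity α m l x * (bump m (x l) ^ 2 * corr α m l x (x l)) := by
  rw [density, ← Finset.mul_prod_erase _ _ (Finset.mem_univ l), mul_pow, mul_assoc,
    exp_sum_pairLog]
  ring

lemma measurable_sum_pairLog (α : ℝ) (m : ℕ) :
    Measurable fun x : Config N => ∑ a, ∑ b, pairLog α m (x a) (x b) :=
  Finset.measurable_fun_sum _ fun a _ => Finset.measurable_fun_sum _ fun b _ =>
    measurable_pairLog_coords α m a b

lemma measurable_density (α : ℝ) (m : ℕ) : Measurable (density α m : Config N → ℝ) :=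
  ((measurable_prod_bump m _).pow_const 2).mul
    (Real.measurable_exp.comp (measurable_sum_pairLog α m))

/-- Comparison of integrals against the density, by integrating out one particle. -/
lemma lintegral_le_of_slice (α : ℝ) (m : ℕ) (l : Fin N) (D : ℝ≥0∞) {f : Config N → ℝ≥0∞}
    {g : Config N → ℝ} {h : Config N → Plane → ℝ≥0∞} (hf : Measurable f) (hg : Measurable g)
    (hg0 : ∀ x, 0 ≤ g x)
    (hgl : ∀ x t, g (Function.update x l t) = g x)
    (hfh : ∀ x t, f (Function.update x l t) ≤
      ENNReal.ofReal (restDensity α m l x) * (ENNReal.ofReal (g x) * h x t))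
    (hh : ∀ x, ∫⁻ t, h x t ≤ D * ∫⁻ t, ENNReal.ofReal (bump m t ^ 2 * corr α m l x t)) :
    ∫⁻ x, f x ≤ D * ∫⁻ x, ENNReal.ofReal (density α m x * g x) := by
  have hmeas : Measurable fun x : Config N => ENNReal.ofReal (density α m x * g x) :=
    ((measurable_density α m).mul hg).ennreal_ofReal
  rw [← lintegral_const_mul _ hmeas]
  -- It suffices to compare the integrals over particle `l` alone, with all others frozen.
  refine lintegral_le_of_lmarginal_le (μ := fun _ : Fin N => (volume : Measure Plane)) {l} hf
    (hmeas.const_mul _) ?_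
  intro x
  rw [lmarginal_singleton, lmarginal_singleton]
  have e : ∀ t, ENNReal.ofReal (density α m (Function.update x l t) * g (Function.update x l t)) =
      ENNReal.ofReal (restDensity α m l x) * (ENNReal.ofReal (g x) *
        ENNReal.ofReal (bump m t ^ 2 * corr α m l x t)) := fun t => by
    rw [density_eq α m l, restDensity_update, corr_update, hgl, Function.update_self,
      ← ENNReal.ofReal_mul (hg0 x), ← ENNReal.ofReal_mul (restDensity_nonneg _ _ _ _)]
    congr 1; ring
  have hcm : Measurable fun t => ENNReal.ofReal (bump m t ^ 2 * corr α m l x t) := by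
    refine (((measurable_bump m).pow_const 2).mul (Real.measurable_exp.comp
      (Measurable.const_mul (Finset.measurable_fun_sum _ fun k _ => ?_) _))).ennreal_ofReal
    exact (measurable_pairLog α m).comp (by fun_prop : Measurable fun t : Plane => (t, x k))
  simp only [e]
  calc _ ≤ _ := lintegral_mono (hfh x)
    _ = ENNReal.ofReal (restDensity α m l x) * (ENNReal.ofReal (g x) * ∫⁻ t, h x t) := by
      rw [lintegral_const_mul' _ _ ENNReal.ofReal_ne_top,
        lintegral_const_mul' _ _ ENNReal.ofReal_ne_top]
    _ ≤ ENNReal.ofReal (restDensity α m l x) * (ENNReal.ofReal (g x) *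
        (D * ∫⁻ t, ENNReal.ofReal (bump m t ^ 2 * corr α m l x t))) := by gcongr; exact hh x
    _ = _ := by
      rw [lintegral_const_mul _ ((hcm.const_mul _).const_mul _),
        lintegral_const_mul' _ _ ENNReal.ofReal_ne_top,
        lintegral_const_mul' _ _ ENNReal.ofReal_ne_top]
      ring

lemma fderiv_bump_eq_zero {m : ℕ} {t : Plane} (ht : t ∉ unitSquare) : fderiv ℝ (bump m) t = 0 := by
  have h : t ∉ gridInterior m := fun h => ht (interior_subset (gridInterior_subset m h))
  rw [(bump_eventually_zero h).fderiv_eq]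
  exact fderiv_const_apply 0

/-- The part of the energy density that comes from the one-particle amplitude. -/
noncomputable def bumpEnergy (α : ℝ) (m : ℕ) (j : Fin N) (i : Fin 2) (x : Config N) : ℝ :=
  (∏ k ∈ Finset.univ.erase j, bump m (x k)) ^ 2 *
    Real.exp (∑ a, ∑ b, pairLog α m (x a) (x b)) *
      fderiv ℝ (bump m) (x j) (EuclideanSpace.single i 1) ^ 2

lemma bumpEnergy_nonneg (α : ℝ) (m : ℕ) (j : Fin N) (i : Fin 2) (x : Config N) :
    0 ≤ bumpEnergy α m j i x := by unfold bumpEnergy; positivity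

lemma measurable_bumpEnergy (α : ℝ) (m : ℕ) (j : Fin N) (i : Fin 2) :
    Measurable (bumpEnergy α m j i) :=
  (((measurable_prod_bump m _).pow_const 2).mul
    (Real.measurable_exp.comp (measurable_sum_pairLog α m))).mul
    (((measurable_fderiv_apply_const ℝ (bump m) _).comp (measurable_pi_apply j)).pow_const 2)

/-! ### Energy estimates: amplitude, two-body and three-body terms. -/

section Estimates

variable {α c K : ℝ} {m : ℕ}

/-- Converts a constant bound on a slice integral into the hypothesis `hh` of
`lintegral_le_of_slice`, at the price of a factor `2 / c`. -/
lemma le_ofReal_mul_lintegral_corr (hα : 0 ≤ α) (hm : 1 ≤ m) (hc : 0 < c)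
    (hb : ∫⁻ t, ENNReal.ofReal (bump m t ^ 2) = ENNReal.ofReal c)
    (hN : 16 * circleLength * α * N ≤ c * m ^ 2) {B : ℝ} (hB : 0 ≤ B) (l : Fin N) (x : Config N) :
    ENNReal.ofReal B ≤ ENNReal.ofReal (2 * B / c) *
      ∫⁻ t, ENNReal.ofReal (bump m t ^ 2 * corr α m l x t) := by
  calc ENNReal.ofReal B = ENNReal.ofReal (2 * B / c) * ENNReal.ofReal (c / 2) := by
        rw [← ENNReal.ofReal_mul (by positivity)]; congr 1; field_simp
    _ ≤ _ := by gcongr; exact lintegral_bump_mul_corr_ge hα hm hc hb hN l x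

lemma lintegral_bumpEnergy_le (hα : 0 ≤ α) (hm : 1 ≤ m) (hc : 0 < c)
    (hb : ∫⁻ t, ENNReal.ofReal (bump m t ^ 2) = ENNReal.ofReal c)
    (hN : 16 * circleLength * α * N ≤ c * m ^ 2)
    (hK : ∀ t, |deriv (bumpLine m) t| ≤ K) (j : Fin N) (i : Fin 2) :
    ∫⁻ x, ENNReal.ofReal (bumpEnergy α m j i x) ≤
      ENNReal.ofReal (2 * (K ^ 2 * volume.real unitSquare) / c) *
        ∫⁻ x : Config N, ENNReal.ofReal (density α m x) := by
  have key := lintegral_le_of_slice α m j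
    (ENNReal.ofReal (2 * (K ^ 2 * volume.real unitSquare) / c))
    (f := fun x => ENNReal.ofReal (bumpEnergy α m j i x)) (g := fun _ => 1)
    (h := fun _ t => ENNReal.ofReal (fderiv ℝ (bump m) t (EuclideanSpace.single i 1) ^ 2))
    (measurable_bumpEnergy α m j i).ennreal_ofReal measurable_const (fun _ => zero_le_one)
    (fun _ _ => rfl) ?_ ?_
  · simpa using key
  · intro x t
    rw [ENNReal.ofReal_one, one_mul, ← ENNReal.ofReal_mul (restDensity_nonneg _ _ _ _), bumpEnergy,
      exp_sum_pairLog, restDensity_update, corr_update, Function.update_self]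
    apply ENNReal.ofReal_le_ofReal
    gcongr
    exact mul_le_of_le_one_right (restDensity_nonneg _ _ _ _) (corr_le_one hα hm j x t)
  · intro x
    refine le_trans ?_ (le_ofReal_mul_lintegral_corr hα hm hc hb hN (by positivity) j x)
    have h1 : ∀ t, ENNReal.ofReal (fderiv ℝ (bump m) t (EuclideanSpace.single i 1) ^ 2) ≤
        unitSquare.indicator (fun _ => ENNReal.ofReal (K ^ 2)) t := fun t => by
      by_cases ht : t ∈ unitSquare
      · rw [Set.indicator_of_mem ht]
        exact ENNReal.ofReal_le_ofReal (sq_le_sq.mpr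
          ((abs_fderiv_bump_le hK t i).trans (le_abs_self K)))
      · simp [fderiv_bump_eq_zero ht]
    refine (lintegral_mono h1).trans ?_
    rw [lintegral_indicator isCompact_unitSquare.measurableSet, setLIntegral_const,
      ENNReal.ofReal_mul (sq_nonneg K), ofReal_measureReal isCompact_unitSquare.measure_lt_top.ne]

/-- The two-body term: particle `j` is integrated out, keeping only its Jastrow factor with `k`. -/
lemma lintegral_density_mul_sq_le (hα : 0 ≤ α) (hm : 1 ≤ m) (hc : 0 < c)
    (hb : ∫⁻ t, ENNReal.ofReal (bump m t ^ 2) = ENNReal.ofReal c)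
    (hN : 16 * circleLength * α * N ≤ c * m ^ 2) {j k : Fin N} (hjk : k ≠ j) :
    ∫⁻ x : Config N, ENNReal.ofReal (density α m x * pairRepulsion α m (x j) (x k) ^ 2) ≤
      ENNReal.ofReal (2 * (circleLength * α) / c) *
        ∫⁻ x : Config N, ENNReal.ofReal (density α m x) := by
  have hκ := circleLength_pos
  have key := lintegral_le_of_slice α m j (ENNReal.ofReal (2 * (circleLength * α) / c))
    (f := fun x => ENNReal.ofReal (density α m x * pairRepulsion α m (x j) (x k) ^ 2))
    (g := fun _ => 1)
    (h := fun x t => ENNReal.ofReal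
      (Real.exp (2 * pairLog α m t (x k)) * pairRepulsion α m t (x k) ^ 2))
    ((measurable_density α m).mul
      ((measurable_pairRepulsion_coords α m j k).pow_const 2)).ennreal_ofReal
    measurable_const (fun _ => zero_le_one) (fun _ _ => rfl) ?_ ?_
  · simpa using key
  · intro x t
    rw [ENNReal.ofReal_one, one_mul, ← ENNReal.ofReal_mul (restDensity_nonneg _ _ _ _),
      density_eq α m j, restDensity_update, corr_update, Function.update_self,
      Function.update_of_ne hjk, mul_assoc]
    apply ENNReal.ofReal_le_ofReal
    have h1 : bump m t ^ 2 ≤ 1 := pow_le_one₀ (bump_nonneg _ _) (bump_le_one _ _)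
    have h2 : bump m t ^ 2 * corr α m j x t ≤ Real.exp (2 * pairLog α m t (x k)) :=
      (mul_le_of_le_one_left (corr_pos α m j x t).le h1).trans (corr_le hα hm hjk x t)
    have := restDensity_nonneg α m j x
    gcongr
  · intro x
    exact (lintegral_pairRepulsion_sq_le hα hm (x k)).trans
      (le_ofReal_mul_lintegral_corr hα hm hc hb hN (by positivity) j x)

/-- Since `1/r` is integrable by itself, amplitude and correlation are simply bounded by 1. The
weight `g`, independent of particle `l`, allows the estimate to be iterated. -/
lemma lintegral_density_mul_pairRepulsion_le (hα : 0 ≤ α) (hm : 1 ≤ m) (hc : 0 < c)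
    (hb : ∫⁻ t, ENNReal.ofReal (bump m t ^ 2) = ENNReal.ofReal c)
    (hN : 16 * circleLength * α * N ≤ c * m ^ 2) {j l : Fin N} (hjl : j ≠ l)
    {g : Config N → ℝ} (hg : Measurable g) (hg0 : ∀ x, 0 ≤ g x)
    (hgl : ∀ x t, g (Function.update x l t) = g x) :
    ∫⁻ x : Config N, ENNReal.ofReal (density α m x * (g x * pairRepulsion α m (x j) (x l))) ≤
      ENNReal.ofReal (2 * (α * (circleLength * (2 / m))) / c) *
        ∫⁻ x : Config N, ENNReal.ofReal (density α m x * g x) := by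
  have hκ := circleLength_pos
  refine lintegral_le_of_slice α m l _ (h := fun x t => ENNReal.ofReal (pairRepulsion α m t (x j)))
    ((measurable_density α m).mul
      (hg.mul (measurable_pairRepulsion_coords α m j l))).ennreal_ofReal hg hg0 hgl ?_ ?_
  · intro x t
    rw [← ENNReal.ofReal_mul (hg0 x), ← ENNReal.ofReal_mul (restDensity_nonneg _ _ _ _),
      density_eq α m l, restDensity_update, corr_update, Function.update_self, hgl,
      Function.update_of_ne hjl, mul_assoc, pairRepulsion_comm α m t]
    apply ENNReal.ofReal_le_ofReal
    have h1 : bump m t ^ 2 ≤ 1 := pow_le_one₀ (bump_nonneg _ _) (bump_le_one _ _)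
    have h2 : bump m t ^ 2 * corr α m l x t ≤ 1 :=
      mul_le_one₀ h1 (corr_pos α m l x t).le (corr_le_one hα hm l x t)
    have := restDensity_nonneg α m l x
    have h3 := mul_nonneg (hg0 x) (pairRepulsion_nonneg hα m (x j) t)
    exact mul_le_mul_of_nonneg_left (mul_le_of_le_one_left h3 h2) this
  · intro x
    exact (lintegral_pairRepulsion_le hα hm (x j)).trans
      (le_ofReal_mul_lintegral_corr hα hm hc hb hN (by positivity) l x)

/-- The three-body term: integrating out `l` and then `k` gives a factor of order `α/m` each time.
As `k ≠ l`, the interaction with `k` passes through the first integration as a weight. -/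
lemma lintegral_density_mul_pairRepulsion_mul_le (hα : 0 ≤ α) (hm : 1 ≤ m) (hc : 0 < c)
    (hb : ∫⁻ t, ENNReal.ofReal (bump m t ^ 2) = ENNReal.ofReal c)
    (hN : 16 * circleLength * α * N ≤ c * m ^ 2) {j k l : Fin N} (hjk : j ≠ k) (hjl : j ≠ l)
    (hkl : k ≠ l) :
    ∫⁻ x : Config N, ENNReal.ofReal
        (density α m x * (pairRepulsion α m (x j) (x k) * pairRepulsion α m (x j) (x l))) ≤
      ENNReal.ofReal ((2 * (α * (circleLength * (2 / m))) / c) ^ 2) *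
        ∫⁻ x : Config N, ENNReal.ofReal (density α m x) := by
  have hκ := circleLength_pos
  have h1 := lintegral_density_mul_pairRepulsion_le hα hm hc hb hN hjl
    (measurable_pairRepulsion_coords α m j k) (fun x => pairRepulsion_nonneg hα m _ _)
    (fun x t => by rw [Function.update_of_ne hjl, Function.update_of_ne hkl])
  have h2 := lintegral_density_mul_pairRepulsion_le hα hm hc hb hN hjk (g := fun _ => 1)
    measurable_const (fun _ => zero_le_one) (fun _ _ => rfl)
  simp only [one_mul, mul_one] at h2
  refine h1.trans ((mul_le_mul_right h2 _).trans (le_of_eq ?_))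
  rw [← mul_assoc, ← ENNReal.ofReal_mul (by positivity), ← sq]

/-- From `(u + v)² ≤ 2u² + 2v²`; the interaction part carries the factor 2 of
`norm_pairGrad_add_le`, hence `8 = 2 * 2²`. -/
lemma enorm_trialGrad_sq_le (hα : 0 ≤ α) (hm : 1 ≤ m) (j : Fin N) (i : Fin 2) (x : Config N) :
    ‖trialGrad α m j i x‖ₑ ^ 2 ≤ 2 * ENNReal.ofReal (bumpEnergy α m j i x) +
      8 * ∑ k ∈ Finset.univ.erase j, ∑ l ∈ Finset.univ.erase j, ENNReal.ofReal
        (density α m x * (pairRepulsion α m (x j) (x k) * pairRepulsion α m (x j) (x l))) := by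
  have hu := fun k => pairRepulsion_nonneg hα m (x j) (x k)
  have h0 : ∀ k l, 0 ≤ density α m x *
      (pairRepulsion α m (x j) (x k) * pairRepulsion α m (x j) (x l)) := fun k l =>
    mul_nonneg (density_nonneg _ _ _) (mul_nonneg (hu k) (hu l))
  have e2 : (2 : ℝ≥0∞) = ENNReal.ofReal 2 := by simp
  have e8 : (8 : ℝ≥0∞) = ENNReal.ofReal 8 := by simp
  have hsum : ∀ k, ∑ l ∈ Finset.univ.erase j, ENNReal.ofReal
        (density α m x * (pairRepulsion α m (x j) (x k) * pairRepulsion α m (x j) (x l))) =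
      ENNReal.ofReal (∑ l ∈ Finset.univ.erase j,
        density α m x * (pairRepulsion α m (x j) (x k) * pairRepulsion α m (x j) (x l))) :=
    fun k => (ENNReal.ofReal_sum_of_nonneg fun l _ => h0 k l).symm
  simp only [hsum]
  rw [← ENNReal.ofReal_sum_of_nonneg fun k _ => Finset.sum_nonneg fun l _ => h0 k l, e2, e8,
    ← ENNReal.ofReal_mul two_pos.le, ← ENNReal.ofReal_mul (by norm_num),
    ← ENNReal.ofReal_add (mul_nonneg two_pos.le (bumpEnergy_nonneg _ _ _ _ _))
      (mul_nonneg (by norm_num) (Finset.sum_nonneg fun k _ => Finset.sum_nonneg fun l _ => h0 k l)),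
    ← ofReal_norm, ← ENNReal.ofReal_pow (norm_nonneg _)]
  apply ENNReal.ofReal_le_ofReal
  simp only [← Finset.mul_sum, ← Finset.sum_mul]
  refine (pow_le_pow_left₀ (norm_nonneg _) (norm_trialGrad_le hα hm j i x) 2).trans ?_
  set e := Real.exp (1 / 2 * ∑ a, ∑ b, pairLog α m (x a) (x b)) with he
  have he2 : Real.exp (∑ a, ∑ b, pairLog α m (x a) (x b)) = e ^ 2 := by
    rw [he, ← Real.exp_nat_mul]; congr 1; push_cast; ring
  rw [bumpEnergy, density, he2, ← sq_abs (fderiv ℝ (bump m) (x j) (EuclideanSpace.single i 1))]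
  set a := (∏ k ∈ Finset.univ.erase j, bump m (x k))
  set p := ∏ k, bump m (x k)
  set d := |fderiv ℝ (bump m) (x j) (EuclideanSpace.single i 1)|
  set u := ∑ k ∈ Finset.univ.erase j, pairRepulsion α m (x j) (x k)
  nlinarith [sq_nonneg (e * (a * d) - e * (p * (2 * u)))]

lemma lintegral_trialGrad_sq_le (hα : 0 ≤ α) (hm : 1 ≤ m) (hc : 0 < c)
    (hb : ∫⁻ t, ENNReal.ofReal (bump m t ^ 2) = ENNReal.ofReal c)
    (hN : 16 * circleLength * α * N ≤ c * m ^ 2)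
    (hK : ∀ t, |deriv (bumpLine m) t| ≤ K) (j : Fin N) (i : Fin 2) :
    ∫⁻ x, ‖trialGrad α m j i x‖ₑ ^ 2 ≤
      ENNReal.ofReal (2 * (2 * (K ^ 2 * volume.real unitSquare) / c) +
        8 * (N * (2 * (circleLength * α) / c +
          N * (2 * (α * (circleLength * (2 / m))) / c) ^ 2))) *
        ∫⁻ x : Config N, ENNReal.ofReal (density α m x) := by
  have hκ := circleLength_pos
  set Z := ∫⁻ x : Config N, ENNReal.ofReal (density α m x)
  set D₂ := 2 * (circleLength * α) / c
  set D₃ := (2 * (α * (circleLength * (2 / m))) / c) ^ 2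
  have hD₂ : 0 ≤ D₂ := by positivity
  have hD₃ : 0 ≤ D₃ := by positivity
  have hmeas : ∀ k l : Fin N, Measurable fun x : Config N => ENNReal.ofReal
      (density α m x * (pairRepulsion α m (x j) (x k) * pairRepulsion α m (x j) (x l))) :=
    fun k l => ((measurable_density α m).mul ((measurable_pairRepulsion_coords α m j k).mul
      (measurable_pairRepulsion_coords α m j l))).ennreal_ofReal
  -- The three-body bound is added also when `k = l`, so that each row sums to `D₂ + N * D₃`.
  have hpair : ∀ k ∈ Finset.univ.erase j, ∀ l ∈ Finset.univ.erase j,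
      ∫⁻ x : Config N, ENNReal.ofReal
        (density α m x * (pairRepulsion α m (x j) (x k) * pairRepulsion α m (x j) (x l))) ≤
      (if k = l then ENNReal.ofReal D₂ * Z else 0) + ENNReal.ofReal D₃ * Z := by
    intro k hk l hl
    by_cases hkl : k = l
    · subst hkl
      rw [if_pos rfl]
      simp only [← sq]
      exact (lintegral_density_mul_sq_le hα hm hc hb hN (Finset.ne_of_mem_erase hk)).trans
        le_self_add
    · rw [if_neg hkl, zero_add]
      exact lintegral_density_mul_pairRepulsion_mul_le hα hm hc hb hN
        (Finset.ne_of_mem_erase hk).symm (Finset.ne_of_mem_erase hl).symm hkl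
  have hrow : ∀ k ∈ Finset.univ.erase j, ∑ l ∈ Finset.univ.erase j,
      ∫⁻ x : Config N, ENNReal.ofReal
        (density α m x * (pairRepulsion α m (x j) (x k) * pairRepulsion α m (x j) (x l))) ≤
      ENNReal.ofReal (D₂ + N * D₃) * Z := by
    intro k hk
    calc _ ≤ ∑ l ∈ Finset.univ.erase j,
          ((if k = l then ENNReal.ofReal D₂ * Z else 0) + ENNReal.ofReal D₃ * Z) :=
          Finset.sum_le_sum fun l hl => hpair k hk l hl
      _ ≤ ∑ l, ((if k = l then ENNReal.ofReal D₂ * Z else 0) + ENNReal.ofReal D₃ * Z) :=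
          Finset.sum_le_sum_of_subset (Finset.erase_subset _ _)
      _ = _ := by
          rw [Finset.sum_add_distrib, Finset.sum_ite_eq, if_pos (Finset.mem_univ k),
            Finset.sum_const, Finset.card_univ, Fintype.card_fin, nsmul_eq_mul,
            ENNReal.ofReal_add hD₂ (by positivity), ENNReal.ofReal_mul (Nat.cast_nonneg N),
            ENNReal.ofReal_natCast]
          ring
  calc _ ≤ _ := lintegral_mono (enorm_trialGrad_sq_le hα hm j i)
    _ = 2 * (∫⁻ x, ENNReal.ofReal (bumpEnergy α m j i x)) +
        8 * ∑ k ∈ Finset.univ.erase j, ∑ l ∈ Finset.univ.erase j, ∫⁻ x : Config N, ENNReal.ofReal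
        (density α m x * (pairRepulsion α m (x j) (x k) * pairRepulsion α m (x j) (x l))) := by
        rw [lintegral_add_left ((measurable_bumpEnergy α m j i).ennreal_ofReal.const_mul _),
          lintegral_const_mul' _ _ (by simp), lintegral_const_mul' _ _ (by simp),
          lintegral_finsetSum _ fun k _ => Finset.measurable_fun_sum _ fun l _ => hmeas k l]
        simp only [lintegral_finsetSum _ fun l _ => hmeas _ l]
    _ ≤ 2 * (ENNReal.ofReal (2 * (K ^ 2 * volume.real unitSquare) / c) * Z) +
        8 * ∑ k : Fin N, ENNReal.ofReal (D₂ + N * D₃) * Z := by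
        gcongr
        · exact lintegral_bumpEnergy_le hα hm hc hb hN hK j i
        · exact (Finset.sum_le_sum hrow).trans
            (Finset.sum_le_sum_of_subset (Finset.erase_subset _ _))
    _ = _ := by
        rw [Finset.sum_const, Finset.card_univ, Fintype.card_fin, nsmul_eq_mul,
          ENNReal.ofReal_add (p := 2 * _) (by positivity) (by positivity),
          ENNReal.ofReal_mul two_pos.le,
          ENNReal.ofReal_mul (by norm_num : (0 : ℝ) ≤ 8), ENNReal.ofReal_mul (Nat.cast_nonneg N),
          ENNReal.ofReal_natCast, ENNReal.ofReal_ofNat, ENNReal.ofReal_ofNat]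
        ring

end Estimates

/-! ### Admissibility of the trial state. -/

lemma memLp_two_of_lintegral_lt_top {f : Config N → ℂ} (hf : AEStronglyMeasurable f)
    (h : ∫⁻ x, ‖f x‖ₑ ^ 2 < ⊤) : MemLp f 2 := by
  refine ⟨hf, ?_⟩
  rw [eLpNorm_lt_top_iff_lintegral_rpow_enorm_lt_top two_ne_zero ENNReal.ofNat_ne_top]
  simpa using h

/-- A trial state does not have to be normalized. -/
lemma dirichletEnergy_le {α : ℝ} {Ω : Set Plane} {Ψ : Config N → ℂ}
    {G : Fin N → Fin 2 → Config N → ℂ} (h : HasMagneticGradient α Ψ G)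
    (hs : HasCompactSupportIn Ω Ψ) (h0 : ∫⁻ x in power N Ω, ‖Ψ x‖ₑ ^ 2 ≠ 0)
    (htop : ∫⁻ x in power N Ω, ‖Ψ x‖ₑ ^ 2 ≠ ⊤) {B : ℝ≥0∞}
    (hB : kineticEnergy Ω G ≤ B * ∫⁻ x in power N Ω, ‖Ψ x‖ₑ ^ 2) :
    dirichletEnergy N α Ω ≤ B := by
  set Z := ∫⁻ x in power N Ω, ‖Ψ x‖ₑ ^ 2 with hZ
  have hZpos : 0 < Z.toReal := ENNReal.toReal_pos h0 htop
  set c : ℂ := (((√Z.toReal)⁻¹ : ℝ) : ℂ) with hc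
  have hc2 : ‖c‖ₑ ^ 2 = Z⁻¹ := by
    rw [← ofReal_norm, hc, Complex.norm_real, Real.norm_of_nonneg (by positivity),
      ← ENNReal.ofReal_pow (by positivity), inv_pow, Real.sq_sqrt hZpos.le,
      ENNReal.ofReal_inv_of_pos hZpos, ENNReal.ofReal_toReal htop]
  have hctop : ‖c‖ₑ ^ 2 ≠ ⊤ := by rw [hc2]; exact ENNReal.inv_ne_top.mpr h0
  have hscale : ∀ f : Config N → ℂ, ∀ x, ‖c * f x‖ₑ ^ 2 = ‖c‖ₑ ^ 2 * ‖f x‖ₑ ^ 2 := fun f x => by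
    rw [enorm_mul, mul_pow]
  have hkin : kineticEnergy Ω (fun j i x => c * G j i x) = Z⁻¹ * kineticEnergy Ω G := by
    simp only [kineticEnergy, hscale, ← Finset.mul_sum]
    simp_rw [lintegral_const_mul' _ _ hctop]
    rw [hc2, Finset.mul_sum]
  refine le_trans (b := kineticEnergy Ω fun j i x => c * G j i x)
    (sInf_le ⟨fun x => c * Ψ x, fun j i x => c * G j i x, ⟨h.memLp.const_mul c, ?_,
    fun j i => (h.memLp_gradient j i).const_mul c, ?_⟩, ?_, ?_, rfl⟩) ?_
  · intro σ
    filter_upwards [h.bosonic σ] with x hx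
    rw [hx]
  · intro j i φ hφ
    simp only [mul_assoc]
    rw [integral_const_mul, integral_const_mul, h.isMagneticGradient j i φ hφ]
    simp only [mul_assoc]
  · obtain ⟨K, hK, hKΩ, hz⟩ := hs
    refine ⟨K, hK, hKΩ, ?_⟩
    filter_upwards [hz] with x hx hxK
    rw [hx hxK, mul_zero]
  · simp only [hscale]
    rw [lintegral_const_mul' _ _ hctop, hc2]
    exact ENNReal.inv_mul_cancel h0 htop
  · rw [hkin]
    calc Z⁻¹ * kineticEnergy Ω G ≤ Z⁻¹ * (B * Z) := by gcongr
      _ = B * (Z⁻¹ * Z) := by ring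
      _ = B := by rw [ENNReal.inv_mul_cancel h0 htop, mul_one]

lemma integral_fderiv_eq_zero_of_contDiff {u : Config N → ℂ} (hu : ContDiff ℝ 1 u)
    (hs : HasCompactSupport u) (v : Config N) :
    Integrable (fun x => fderiv ℝ u x v) ∧ ∫ x, fderiv ℝ u x v = 0 := by
  have h1 : Integrable fun x => fderiv ℝ u x v :=
    ((hu.continuous_fderiv one_ne_zero).clm_apply continuous_const).integrable_of_hasCompactSupport
      (hs.fderiv_apply ℝ v)
  have h2 : Integrable u := hu.continuous.integrable_of_hasCompactSupport hs
  refine ⟨h1, ?_⟩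
  have h3 := integral_smul_fderiv_eq_neg_fderiv_smul_of_integrable (μ := volume) (𝕜 := ℂ) (f := u)
    (g := fun _ : Config N => (1 : ℂ)) (v := v) (by simpa using h1) (by simp) (by simpa using h2)
    (fun x _ => (hu.differentiable one_ne_zero).differentiableAt)
    (fun x _ => differentiableAt_const _)
  simpa using h3

lemma measurableSet_offDiagonal : MeasurableSet (offDiagonal N) := by
  have : offDiagonal N = ⋂ (a) (b) (_ : a ≠ b), {x : Config N | x a = x b}ᶜ := by
    ext x
    simp only [offDiagonal, Set.mem_ofPred_eq, Set.mem_iInter, Set.mem_compl_iff]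
    exact ⟨fun h a b hab e => hab (h e), fun h a b e => by_contra fun hab => h a b hab e⟩
  rw [this]
  exact MeasurableSet.iInter fun a => MeasurableSet.iInter fun b => MeasurableSet.iInter fun _ =>
    (measurableSet_eq_fun (measurable_pi_apply a) (measurable_pi_apply b)).compl

lemma measurable_invPerp_apply (i : Fin 2) : Measurable fun w : Plane => invPerp w i := by
  unfold invPerp
  fin_cases i
  · simp only [Fin.zero_eta, PiLp.smul_apply, smul_eq_mul, Matrix.cons_val_zero]
    fun_prop
  · simp only [Fin.mk_one, PiLp.smul_apply, smul_eq_mul, Matrix.cons_val_one, Matrix.cons_val_zero]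
    fun_prop

lemma measurable_vecPot_apply (j : Fin N) (i : Fin 2) :
    Measurable fun x : Config N => vecPot j x i := by
  have : (fun x : Config N => vecPot j x i) =
      fun x => ∑ k ∈ Finset.univ.erase j, invPerp (x j - x k) i := by
    ext x; simp [vecPot]
  rw [this]
  exact Finset.measurable_fun_sum _ fun k _ => (measurable_invPerp_apply i).comp
    (by fun_prop : Measurable fun x : Config N => x j - x k)

lemma measurable_trialGrad (α : ℝ) (m : ℕ) (j : Fin N) (i : Fin 2) :
    Measurable (trialGrad α m j i) := by
  refine Measurable.indicator ?_ measurableSet_offDiagonal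
  exact ((measurable_fderiv_apply_const ℝ (trial α m) _).const_mul _).add
    (((Complex.measurable_ofReal.comp (measurable_vecPot_apply j i)).const_mul _).mul
      (measurable_trial α m))

/-- Integration by parts. The test function vanishes near the diagonals, so its product with the
trial state is `C¹` with compact support on the whole space, and the integral of its derivative
vanishes. -/
lemma isMagneticGradient_trial (α : ℝ) {m : ℕ} (hm : 1 ≤ m)
    (hG : ∀ j i, MemLp (trialGrad α m j i : Config N → ℂ) 2) :
    IsMagneticGradient α (trial α m) (trialGrad α m : Fin N → Fin 2 → Config N → ℂ) := by
  intro j i φ hφ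
  set u : Config N → ℂ := fun x => trial α m x * φ x with hu
  have husupp : tsupport u ⊆ tsupport φ := tsupport_mul_subset_right
  have hut : ContDiff ℝ 1 u := contDiff_iff_contDiffAt.mpr fun x => by
    by_cases hx : x ∈ tsupport u
    · exact (contDiffAt_trial α hm (hφ.support_subset (husupp hx))).mul
        (hφ.smooth.contDiffAt.of_le (by exact_mod_cast le_top))
    · exact contDiffAt_const.congr_of_eventuallyEq (notMem_tsupport_iff_eventuallyEq.mp hx)
  obtain ⟨hi, hz⟩ := integral_fderiv_eq_zero_of_contDiff hut
    (hφ.compact_support.mul_left) (direction j i)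
  have hφ2 : MemLp φ 2 := hφ.smooth.continuous.memLp_of_hasCompactSupport hφ.compact_support
  have hGφ : Integrable fun x => trialGrad α m j i x * φ x := (hG j i).integrable_mul hφ2
  have key : ∀ x, trial α m x * (Complex.I * fderiv ℝ φ x (direction j i)
        + (α : ℂ) * ((vecPot j x i : ℝ) : ℂ) * φ x) =
      trialGrad α m j i x * φ x + Complex.I * fderiv ℝ u x (direction j i) := by
    intro x
    by_cases hx : x ∈ tsupport φ
    · have hx' := hφ.support_subset hx
      have h1 := ((contDiffAt_trial α hm hx').differentiableAt one_ne_zero).hasFDerivAt.mul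
        ((hφ.smooth.differentiable (by simp)).differentiableAt (x := x)).hasFDerivAt
      have h2 : fderiv ℝ u x = _ := h1.fderiv
      rw [h2, trialGrad, Set.indicator_of_mem hx']
      simp only [_root_.add_apply, _root_.smul_apply, smul_eq_mul]
      ring
    · have h1 : fderiv ℝ φ x = 0 := fderiv_of_notMem_tsupport ℝ hx
      have h2 : fderiv ℝ u x = 0 := fderiv_of_notMem_tsupport ℝ fun h => hx (husupp h)
      have h3 : φ x = 0 := image_eq_zero_of_notMem_tsupport hx
      rw [h1, h2, h3]; simp
  simp only [key]
  rw [integral_add hGφ (hi.const_mul _), integral_const_mul, hz, mul_zero, add_zero]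

/-- The exponent sums over all ordered pairs, so relabelling the particles only reorders the sum;
the phase need not be symmetric for this. -/
lemma trial_comp_perm (α : ℝ) (m : ℕ) (σ : Equiv.Perm (Fin N)) (x : Config N) :
    trial α m (x ∘ σ) = trial α m x := by
  have h1 : ∏ j, bump m ((x ∘ σ) j) = ∏ j, bump m (x j) :=
    Equiv.prod_comp σ fun j => bump m (x j)
  have h2 : trialExponent α m (x ∘ σ) = trialExponent α m x := by
    unfold trialExponent
    congr 1
    rw [← Equiv.sum_comp σ fun a => ∑ b, pairExponent α m (x a) (x b)]
    refine Finset.sum_congr rfl fun a _ => ?_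
    exact Equiv.sum_comp σ fun b => pairExponent α m (x (σ a)) (x b)
  rw [trial, trial, h1, h2]

lemma enorm_trial_sq (α : ℝ) (m : ℕ) (x : Config N) :
    ‖trial α m x‖ₑ ^ 2 = ENNReal.ofReal (density α m x) := by
  rw [← ofReal_norm, ← ENNReal.ofReal_pow (norm_nonneg _), trial, norm_mul, Complex.norm_real,
    Complex.norm_exp, trialExponent_re, mul_pow, Real.norm_eq_abs, sq_abs, ← Real.exp_nat_mul,
    density]
  congr 4; push_cast; ring

lemma density_le_one {α : ℝ} (hα : 0 ≤ α) {m : ℕ} (hm : 1 ≤ m) (x : Config N) :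
    density α m x ≤ 1 := by
  refine mul_le_one₀ (pow_le_one₀ (Finset.prod_nonneg fun _ _ => bump_nonneg _ _)
    (Finset.prod_le_one (fun _ _ => bump_nonneg _ _) fun _ _ => bump_le_one _ _))
    (Real.exp_pos _).le (Real.exp_le_one_iff.mpr ?_)
  exact Finset.sum_nonpos fun a _ => Finset.sum_nonpos fun b _ => pairLog_nonpos hα hm _ _

lemma trial_eq_zero (α : ℝ) {m : ℕ} {x : Config N} (hx : x ∉ power N (tsupport (bump m))) :
    trial α m x = 0 := by
  obtain ⟨j, hj⟩ : ∃ j, x j ∉ tsupport (bump m) := by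
    simpa [power, Set.mem_pi] using hx
  have : ∏ j, bump m (x j) = 0 :=
    Finset.prod_eq_zero (Finset.mem_univ j) (image_eq_zero_of_notMem_tsupport hj)
  simp [trial, this]

lemma isCompact_power_unitSquare : IsCompact (power N unitSquare) :=
  isCompact_univ_pi fun _ => isCompact_unitSquare

lemma setLIntegral_trial (α : ℝ) (m : ℕ) :
    ∫⁻ x in power N unitSquare, ‖trial α m x‖ₑ ^ 2 =
      ∫⁻ x : Config N, ENNReal.ofReal (density α m x) := by
  rw [← lintegral_indicator isCompact_power_unitSquare.measurableSet]
  refine lintegral_congr fun x => ?_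
  rw [← enorm_trial_sq]
  by_cases hx : x ∈ power N unitSquare
  · rw [Set.indicator_of_mem hx]
  · rw [Set.indicator_of_notMem hx, trial_eq_zero α fun h => hx ?_]
    · simp
    · exact fun j hj => interior_subset (gridInterior_subset m (tsupport_bump_subset m (h j hj)))

lemma lintegral_density_lt_top {α : ℝ} (hα : 0 ≤ α) {m : ℕ} (hm : 1 ≤ m) :
    ∫⁻ x : Config N, ENNReal.ofReal (density α m x) < ⊤ := by
  rw [← setLIntegral_trial]
  simp only [enorm_trial_sq]
  calc _ ≤ ∫⁻ x in power N unitSquare, 1 :=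
        lintegral_mono fun x => ENNReal.ofReal_le_one.mpr (density_le_one hα hm x)
    _ < ⊤ := by
        rw [setLIntegral_one]; exact isCompact_power_unitSquare.measure_lt_top

lemma lintegral_density_ne_zero (α : ℝ) {m : ℕ} {c : ℝ} (hc : 0 < c)
    (hb : ∫⁻ t, ENNReal.ofReal (bump m t ^ 2) = ENNReal.ofReal c) :
    ∫⁻ x : Config N, ENNReal.ofReal (density α m x) ≠ 0 := by
  intro h
  obtain ⟨t, ht⟩ : ∃ t, bump m t ≠ 0 := by
    by_contra! h0
    simp only [h0] at hb
    simp at hb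
    linarith
  rw [lintegral_eq_zero_iff (measurable_density α m).ennreal_ofReal] at h
  set U : Set (Config N) := {x | ∏ j, bump m (x j) ≠ 0} with hU
  have hUo : IsOpen U := isOpen_ne_fun (contDiff_prod_bump m).continuous continuous_const
  -- All particles may sit at the same point `t`: the exponential factor is positive everywhere,
  -- diagonals included.
  have hUn : U.Nonempty := ⟨fun _ => t, by simp [hU, ht]⟩
  refine (hUo.measure_pos volume hUn).ne' (measure_mono_null ?_ h)
  intro x hx hx0
  have h1 : 0 < density α m x := mul_pos (by have : ∏ j, bump m (x j) ≠ 0 := hx; positivity)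
    (Real.exp_pos _)
  have h2 : ENNReal.ofReal (density α m x) = 0 := hx0
  exact absurd (ENNReal.ofReal_eq_zero.mp h2) (not_le.mpr h1)

/-! ### Energy for a given mesh, and the choice of the mesh. -/

/-- The energy bound for a given mesh of the grid. -/
lemma dirichletEnergy_unitSquare_le {α c K : ℝ} {m : ℕ} (hα : 0 ≤ α) (hm : 1 ≤ m) (hc : 0 < c)
    (hb : ∫⁻ t, ENNReal.ofReal (bump m t ^ 2) = ENNReal.ofReal c)
    (hN : 16 * circleLength * α * N ≤ c * m ^ 2)
    (hK : ∀ t, |deriv (bumpLine m) t| ≤ K) :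
    dirichletEnergy N α unitSquare ≤ ENNReal.ofReal (N * (2 *
      (2 * (2 * (K ^ 2 * volume.real unitSquare) / c) +
        8 * (N * (2 * (circleLength * α) / c +
          N * (2 * (α * (circleLength * (2 / m))) / c) ^ 2))))) := by
  have hκ := circleLength_pos
  have hG := fun j i => lintegral_trialGrad_sq_le (N := N) hα hm hc hb hN hK j i
  have hZ := lintegral_density_lt_top (N := N) hα hm
  have hG2 : ∀ j i, MemLp (trialGrad α m j i : Config N → ℂ) 2 := fun j i =>
    memLp_two_of_lintegral_lt_top (measurable_trialGrad α m j i).aestronglyMeasurable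
      ((hG j i).trans_lt (ENNReal.mul_lt_top ENNReal.ofReal_lt_top hZ))
  refine dirichletEnergy_le (Ψ := trial α m) (G := trialGrad α m) ⟨?_, ?_, hG2,
    isMagneticGradient_trial α hm hG2⟩ ⟨tsupport (bump m), isCompact_tsupport_bump m,
      (tsupport_bump_subset m).trans (gridInterior_subset m),
      Eventually.of_forall fun x hx => trial_eq_zero α hx⟩ ?_ ?_ ?_
  · refine memLp_two_of_lintegral_lt_top (measurable_trial α m).aestronglyMeasurable ?_
    simpa only [enorm_trial_sq] using hZ
  · exact fun σ => Eventually.of_forall fun x => trial_comp_perm α m σ x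
  · rw [setLIntegral_trial]; exact lintegral_density_ne_zero α hc hb
  · rw [setLIntegral_trial]; exact hZ.ne
  · rw [setLIntegral_trial, kineticEnergy]
    set E := 2 * (2 * (K ^ 2 * volume.real unitSquare) / c) +
        8 * (N * (2 * (circleLength * α) / c + N * (2 * (α * (circleLength * (2 / m))) / c) ^ 2))
    set Z := ∫⁻ x : Config N, ENNReal.ofReal (density α m x)
    have h1 : ∀ j : Fin N, ∫⁻ x in power N unitSquare, ∑ i, ‖trialGrad α m j i x‖ₑ ^ 2 ≤
        2 * (ENNReal.ofReal E * Z) := fun j => by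
      refine (setLIntegral_le_lintegral _ _).trans ?_
      rw [lintegral_finsetSum _ fun i _ => (measurable_trialGrad α m j i).enorm.pow_const 2]
      refine (Finset.sum_le_sum fun i _ => hG j i).trans ?_
      simp [two_mul]
    refine (Finset.sum_le_sum fun j _ => h1 j).trans (le_of_eq ?_)
    rw [Finset.sum_const, Finset.card_univ, Fintype.card_fin, nsmul_eq_mul,
      ENNReal.ofReal_mul (Nat.cast_nonneg N), ENNReal.ofReal_mul two_pos.le,
      ENNReal.ofReal_natCast, ENNReal.ofReal_ofNat]
    ring

end Anyon

open Anyon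

theorem mainTheorem3 :
    ∃ C : ℝ, 0 < C ∧ ∀ α : ℝ, 0 ≤ α → α ≤ 1 → ∀ N : ℕ, 1 ≤ N →
      Anyon.dirichletEnergy N α Anyon.unitSquare ≤
        ENNReal.ofReal (C * ((N : ℝ) + α * (N : ℝ) ^ 2)) := by
  obtain ⟨c, hc, hb⟩ := exists_lintegral_bump_sq_eq
  obtain ⟨K, hK0, hK⟩ := exists_deriv_bumpLine_bound
  set κ := circleLength with hκdef
  have hκ : 0 < κ := circleLength_pos
  set V := (volume : MeasureTheory.Measure Plane).real unitSquare
  have hV : 0 ≤ V := MeasureTheory.measureReal_nonneg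
  set a := κ / c with ha
  have ha0 : 0 < a := by positivity
  set b := K ^ 2 * V / c with hbdef
  have hb0 : 0 ≤ b := by positivity
  -- Here `4 * b * (32 * a + 8)` comes from the amplitude through `m² ≤ 2s + 8`, and `24 * a = 8 *
  -- (2 * a + a)` from the two- and three-body terms. The outer 2 counts the components of `D_j`.
  refine ⟨2 * (4 * b * (32 * a + 8) + 24 * a), by positivity, fun α hα _ N _ => ?_⟩
  set s := 16 * a * (α * N) with hs
  have hs0 : 0 ≤ s := by positivity
  -- The inequality `s ≤ m²` is exactly the mesh condition `hN`. The added 1 keeps `m` positive when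
  -- `α = 0`.
  set m := ⌈√s⌉₊ + 1 with hmdef
  have hm1 : 1 ≤ m := by omega
  have hmpos : (0 : ℝ) < m := by positivity
  have hmge : √s ≤ m := (Nat.le_ceil _).trans (by rw [hmdef]; push_cast; linarith)
  have hmle : (m : ℝ) ≤ √s + 2 := by
    have := Nat.ceil_lt_add_one (Real.sqrt_nonneg s)
    rw [hmdef]; push_cast; linarith
  have hm2 : s ≤ (m : ℝ) ^ 2 := by
    rw [← Real.sq_sqrt hs0]; exact pow_le_pow_left₀ (Real.sqrt_nonneg s) hmge 2
  have hm3 : (m : ℝ) ^ 2 ≤ 2 * s + 8 := by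
    have h1 := pow_le_pow_left₀ hmpos.le hmle 2
    nlinarith [Real.sq_sqrt hs0, sq_nonneg (√s - 2)]
  have hN : 16 * κ * α * N ≤ c * m ^ 2 := by
    have : 16 * κ * α * N = c * s := by rw [hs, ha]; field_simp
    rw [this]; gcongr
  refine (dirichletEnergy_unitSquare_le hα hm1 hc (hb m hm1) hN (hK m)).trans
    (ENNReal.ofReal_le_ofReal ?_)
  have e1 : 2 * (2 * ((K * m) ^ 2 * V) / c) = 4 * b * m ^ 2 := by rw [hbdef]; field_simp; ring
  have e2 : 2 * (κ * α) / c = 2 * a * α := by rw [ha]; ring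
  -- The choice of `m²` absorbs one factor `αN` here, reducing the three-body term to the size of
  -- the two-body term.
  have e3 : N * (2 * (α * (κ * (2 / m))) / c) ^ 2 = a * α * (s / m ^ 2) := by
    rw [hs, ha]; field_simp; ring
  have h4 : s / (m : ℝ) ^ 2 ≤ 1 := div_le_one_of_le₀ hm2 (by positivity)
  rw [e1, e2, e3]
  have hn : (0 : ℝ) ≤ N := Nat.cast_nonneg N
  have h5 : a * α * (s / (m : ℝ) ^ 2) ≤ a * α := mul_le_of_le_one_right (by positivity) h4
  have hp : 0 ≤ α * N := by positivity
  calc (N : ℝ) * (2 * (4 * b * m ^ 2 + 8 * (N * (2 * a * α + a * α * (s / m ^ 2)))))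
      ≤ N * (2 * (4 * b * (2 * s + 8) + 8 * (N * (2 * a * α + a * α)))) := by gcongr
    _ = N * (2 * (4 * b * (32 * a * (α * N) + 8 * 1) + 24 * a * (α * N))) := by
        rw [hs]; ring
    _ ≤ N * (2 * (4 * b * (32 * a * (1 + α * N) + 8 * (1 + α * N)) + 24 * a * (1 + α * N))) := by
        gcongr <;> linarith
    _ = _ := by ring
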